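/- Fix $\alpha>0$ and $n>0$. Let $\Sigma_0>0$ and $\lambda>0$, and put $c_\lambda=1+\lambda\frac{n+1}{\alpha}$. Then there exist even functions $U_\lambda,\Sigma_\lambda,\Theta_\lambda:\mathbb R\to\mathbb R$ with $U_\lambda>0$ which on $[0,\infty)$ solve the singular initial value problem $$\Sigma'=\xi U,\qquad \lambda\Big(\tfrac{n+1}{\alpha}+\xi\,\Theta'\Big)=\Sigma U-1,\qquad \Sigma=e^{-\alpha\Theta}U^n,\qquad \Sigma(0)=\Sigma_0,$$ and have the following properties. * $U_\lambda,\Theta_\lambda\in C^1[0,\infty)$ and $\Sigma_\lambda\in C^2[0,\infty)$. With $U_0:=U_\lambda(0)$ and $\Theta_0:=\Theta_\lambda(0)$ one has $U_0\Sigma_0=c_\lambda$ and $\Theta_0=\frac{n+1}{\alpha}\log U_0-\frac1\alpha\log c_\lambda$; moreover $U_\lambda'(0)=\Sigma_\lambda'(0)=\Theta_\lambda'(0)=0$, and as $\xi\to0^+$, $U_\lambda(\xi)=U_0+o(\xi)$, $\Sigma_\lambda(\xi)=\Sigma_0+\frac12U_0\xi^2+o(\xi^2)$, $\Theta_\lambda(\xi)=\Theta_0+o(\xi)$.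 * As $\xi\to\infty$, $U_\lambda(\xi)=\frac1\xi+o(\frac1\xi)$, $\Sigma_\lambda(\xi)=\xi+o(\xi)$, $\Theta_\lambda(\xi)=-\frac{n+1}{\alpha}\log\xi+o(1)$. Furthermore, for every $\theta_0>0$, with $c_0=e^{\alpha\theta_0}$, $\theta_s(t)=\frac1\alpha\log(\alpha t+c_0)$, $\sigma_s(t)=\frac1{\alpha t+c_0}$ and $\phi_\lambda(t)=\big(\frac{\alpha}{c_0}t+1\big)^{\lambda/\alpha}$, the functions $$u(x,t)=\phi_\lambda(t)\,U_\lambda\big(\sqrt\lambda\,x\,\phi_\lambda(t)\big),\qquad \sigma(x,t)=\frac{\sigma_s(t)}{\phi_\lambda(t)}\,\Sigma_\lambda\big(\sqrt\lambda\,x\,\phi_\lambda(t)\big),$$ $$\theta(x,t)=\Big(1+\lambda\tfrac{n+1}{\alpha}\Big)\theta_s(t)-\lambda\tfrac{n+1}{\alpha}\theta_0+\Theta_\lambda\big(\sqrt\lambda\,x\,\phi_\lambda(t)\big)$$ form a classical solution, with $u>0$, $u,\theta\in C^1(\mathbb R\times[0,\infty))$ and $\sigma\in C^2(\mathbb R\times[0,\infty))$,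 of the system $$u_t=\sigma_{xx},\qquad \theta_t=\sigma u,\qquad \sigma=e^{-\alpha\theta}u^n\qquad\text{on }\mathbb R\times[0,\infty).$$ The solution localizes at $x=0$: $\phi_\lambda(t)\to\infty$ as $t\to\infty$, so that every level curve $\{\sqrt\lambda\,x\,\phi_\lambda(t)=\xi\}$, $\xi\in\mathbb R$, satisfies $x\to0$ as $t\to\infty$. -/

import Mathlib

open Set Filter Topology Asymptotics

/-- Uniform shear temperature, `θ_s(t) = (1/α) log (α t + c₀)` with `c₀ = exp (α θ₀)`. -/
noncomputable def uniformTemp (α θ₀ t : ℝ) : ℝ :=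
  1 / α * Real.log (α * t + Real.exp (α * θ₀))

/-- Uniform shear stress, `σ_s(t) = 1 / (α t + c₀)` with `c₀ = exp (α θ₀)`. -/
noncomputable def uniformStress (α θ₀ t : ℝ) : ℝ :=
  1 / (α * t + Real.exp (α * θ₀))

/-- The scaling factor `φ_lam(t) = (α t / c₀ + 1) ^ (lam / α)` with `c₀ = exp (α θ₀)`. -/
noncomputable def bandScale (α θ₀ lam t : ℝ) : ℝ :=
  (α / Real.exp (α * θ₀) * t + 1) ^ (lam / α)

/-- The constant `c_ν = 1 + ν (n + 1) / α`. -/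
noncomputable def profileConst (α n ν : ℝ) : ℝ :=
  1 + ν * ((n + 1) / α)

/-- `(U, S, Θ)` restricted to `[0, ∞)` is a solution of the singular initial value problem
`S' = ξ U`, `ν ((n + 1) / α + ξ Θ') = S U - 1`, `S = exp (-α Θ) U ^ n`, `S(0) = S₀`, with `U > 0`,
and has the regularity and the behaviour at the origin and at infinity listed below. All
conditions concern only the values on `[0, ∞)`. -/
structure IsShearProfile (α n ν S₀ : ℝ) (U S Θ : ℝ → ℝ) : Prop where
  U_pos : ∀ ξ, 0 ≤ ξ → 0 < U ξ
  -- the system on the half line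
  stress_deriv : ∀ ξ, 0 ≤ ξ → HasDerivWithinAt S (ξ * U ξ) (Ici 0) ξ
  energy : ∀ ξ, 0 ≤ ξ → ν * ((n + 1) / α + ξ * derivWithin Θ (Ici 0) ξ) = S ξ * U ξ - 1
  constitutive : ∀ ξ, 0 ≤ ξ → S ξ = Real.exp (-α * Θ ξ) * U ξ ^ n
  -- the values at the origin
  S_zero : S 0 = S₀
  U_zero : U 0 * S₀ = profileConst α n ν
  Θ_zero : Θ 0 = (n + 1) / α * Real.log (U 0) - 1 / α * Real.log (profileConst α n ν)
  -- regularity up to the origin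
  U_contDiff : ContDiffOn ℝ 1 U (Ici 0)
  Θ_contDiff : ContDiffOn ℝ 1 Θ (Ici 0)
  S_contDiff : ContDiffOn ℝ 2 S (Ici 0)
  U_deriv_zero : HasDerivWithinAt U 0 (Ici 0) 0
  S_deriv_zero : HasDerivWithinAt S 0 (Ici 0) 0
  Θ_deriv_zero : HasDerivWithinAt Θ 0 (Ici 0) 0
  -- Taylor expansion at the origin
  U_taylor : (fun ξ => U ξ - U 0) =o[𝓝[>] 0] (fun ξ => ξ)
  S_taylor : (fun ξ => S ξ - (S₀ + 1 / 2 * U 0 * ξ ^ 2)) =o[𝓝[>] 0] (fun ξ => ξ ^ 2)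
  Θ_taylor : (fun ξ => Θ ξ - Θ 0) =o[𝓝[>] 0] (fun ξ => ξ)
  -- behaviour at infinity
  U_atTop : (fun ξ => U ξ - 1 / ξ) =o[atTop] (fun ξ => 1 / ξ)
  S_atTop : (fun ξ => S ξ - ξ) =o[atTop] (fun ξ => ξ)
  Θ_atTop : Tendsto (fun ξ => Θ ξ + (n + 1) / α * Real.log ξ) atTop (𝓝 0)

/-- `(u, σ, θ)`, written as functions of `x` and `t`, is a classical solution with positive strain
rate `u` of `u_t = σ_xx`, `θ_t = σ u`, `σ = exp (-α θ) u ^ n` on `ℝ × [0, ∞)`. The time derivatives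
are one-sided at `t = 0` and ordinary ones for `t > 0`. -/
structure IsAdiabaticShearSolution (α n : ℝ) (u σ θ : ℝ → ℝ → ℝ) : Prop where
  u_pos : ∀ x t, 0 ≤ t → 0 < u x t
  u_contDiff : ContDiffOn ℝ 1 (fun p : ℝ × ℝ => u p.1 p.2) (univ ×ˢ Ici 0)
  θ_contDiff : ContDiffOn ℝ 1 (fun p : ℝ × ℝ => θ p.1 p.2) (univ ×ˢ Ici 0)
  σ_contDiff : ContDiffOn ℝ 2 (fun p : ℝ × ℝ => σ p.1 p.2) (univ ×ˢ Ici 0)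
  momentum : ∀ x t, 0 ≤ t →
    HasDerivWithinAt (fun s => u x s) (iteratedDeriv 2 (fun y => σ y t) x) (Ici 0) t
  energy : ∀ x t, 0 ≤ t → HasDerivWithinAt (fun s => θ x s) (σ x t * u x t) (Ici 0) t
  constitutive : ∀ x t, 0 ≤ t → σ x t = Real.exp (-α * θ x t) * u x t ^ n

/-! Eliminating `Θ` through the constitutive law leaves a system for `(U, S)` with `a = α/(λ n)` and
`b = 1/n`. It is scale invariant, so with `x = (ξ/S)²` and `p = S U` it becomes the planar
autonomous system dx/d(log ξ) = 2x(1 - xp), dp/d(log ξ) = p((a + (1+b)x)p - (a+1+b)). The profile is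
the orbit joining the node `(0, c)`, `c = (a+1+b)/a = c_λ`, to the saddle `(1, 1)`: the node encodes
the data at `ξ = 0`, the saddle the behaviour at infinity.

The region `1 ≤ p ≤ phaseNullcline` traps solutions followed to the left, and 1 - xp is positive
there. Solutions with value 1 at right endpoints tending to 1 increase to the orbit
(`exists_phase_curve`). The node's linearization gives p - c = O(x^γ) with γ > 1/2
(`exists_phase_curve_rate`); since x is of order ξ², this is what makes `U` and `Θ` of class C¹ with
zero derivative at the origin.

A quadrature then recovers log S as a function of x (`exists_logStress`), and ξ = m S(m²) is
inverted as an odd function of m = ξ/S (`exists_odd_inverse`), so the profiles come out even on the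
whole line. The self-similar fields solve the PDE by direct differentiation, since θ_s' = σ_s and φ'
= λ σ_s φ. -/

/-- The slope `dp/dx` of the product `p = S U` of a profile as a function of `x = (ξ / S) ^ 2`. -/
noncomputable def phaseSlope (a b x p : ℝ) : ℝ :=
  p * ((a + (1 + b) * x) * p - (a + 1 + b)) / (2 * x * (1 - x * p))

/-- The nullcline of `phaseSlope`. -/
noncomputable def phaseNullcline (a b x : ℝ) : ℝ :=
  (a + 1 + b) / (a + (1 + b) * x)

/-! ### Invariant region of the phase equation -/

section Phase

variable {a b : ℝ}

lemma one_le_phaseNullcline (ha : 0 < a) (hb : 0 < b) {x : ℝ} (hx : x ∈ Ioo (0 : ℝ) 1) :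
    1 < phaseNullcline a b x := by
  have hx0 := hx.1
  have : 0 < a + (1 + b) * x := by positivity
  rw [phaseNullcline, lt_div_iff₀ this]
  nlinarith [hx.2]

lemma phaseNullcline_le (ha : 0 < a) (hb : 0 < b) {x : ℝ} (hx : 0 ≤ x) :
    phaseNullcline a b x ≤ (a + 1 + b) / a := by
  rw [phaseNullcline]
  gcongr
  nlinarith

/-- The inequality x(a+1+b) < a + (1+b)x reduces to ax < a. It keeps the denominator of `phaseSlope`
away from its zero set. -/
lemma mul_lt_one_of_le_phaseNullcline (ha : 0 < a) (hb : 0 < b) {x p : ℝ}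
    (hx : x ∈ Ioo (0 : ℝ) 1) (hp : p ≤ phaseNullcline a b x) : x * p < 1 := by
  have hx0 := hx.1
  have : 0 < a + (1 + b) * x := by positivity
  rw [phaseNullcline, le_div_iff₀ this] at hp
  have h2 : (x * p) * (a + (1 + b) * x) < 1 * (a + (1 + b) * x) := by
    nlinarith [hx.2, mul_pos ha (sub_pos.2 hx.2)]
  exact lt_of_mul_lt_mul_right h2 this.le

lemma phaseSlope_nonpos (ha : 0 < a) (hb : 0 < b) {x p : ℝ} (hx : x ∈ Ioo (0 : ℝ) 1)
    (hp : p ∈ Icc 1 (phaseNullcline a b x)) : phaseSlope a b x p ≤ 0 := by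
  have hx0 := hx.1
  have h1 := mul_lt_one_of_le_phaseNullcline ha hb hx hp.2
  have h2 : 0 < a + (1 + b) * x := by positivity
  have h3 := hp.2
  rw [phaseNullcline, le_div_iff₀ h2] at h3
  have h4 := hp.1
  have h5 : 0 < 1 - x * p := by linarith
  apply div_nonpos_of_nonpos_of_nonneg
  · apply mul_nonpos_of_nonneg_of_nonpos <;> nlinarith
  · positivity

lemma phaseSlope_phaseNullcline (ha : 0 < a) (hb : 0 < b) {x : ℝ} (hx : 0 < x) :
    phaseSlope a b x (phaseNullcline a b x) = 0 := by
  have h2 : a + (1 + b) * x ≠ 0 := by positivity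
  rw [phaseSlope, phaseNullcline, mul_div_cancel₀ _ h2]
  simp

lemma hasDerivAt_phaseNullcline (ha : 0 < a) (hb : 0 < b) {x : ℝ} (hx : 0 < x) :
    HasDerivAt (phaseNullcline a b)
      (-((a + 1 + b) * (1 + b)) / (a + (1 + b) * x) ^ 2) x := by
  have h2 : a + (1 + b) * x ≠ 0 := by positivity
  have := (hasDerivAt_const x (a + 1 + b)).div
    (((hasDerivAt_id x).const_mul (1 + b)).const_add a) h2
  exact this.congr_deriv (by simp)

/-- The part of the phase region over a compact interval is compact. -/
lemma isCompact_phaseRegion (ha : 0 < a) (hb : 0 < b) {l r : ℝ} (hl : 0 < l) :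
    IsCompact {z : ℝ × ℝ | z.1 ∈ Icc l r ∧ z.2 ∈ Icc 1 (phaseNullcline a b z.1)} := by
  -- Clearing the denominator of the nullcline turns the upper bound into a polynomial inequality,
  -- which is visibly closed.
  have : {z : ℝ × ℝ | z.1 ∈ Icc l r ∧ z.2 ∈ Icc 1 (phaseNullcline a b z.1)} =
      (Icc l r ×ˢ Icc 1 ((a + 1 + b) / a)) ∩
        {z : ℝ × ℝ | z.2 * (a + (1 + b) * z.1) ≤ a + 1 + b} := by
    ext z
    simp only [mem_ofPred_eq, mem_inter_iff, mem_prod, mem_Icc]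
    constructor
    · rintro ⟨h1, h2, h3⟩
      have hz : 0 < z.1 := hl.trans_le h1.1
      refine ⟨⟨h1, h2, h3.trans (phaseNullcline_le ha hb hz.le)⟩, ?_⟩
      rwa [phaseNullcline, le_div_iff₀ (by positivity)] at h3
    · rintro ⟨⟨h1, h2, -⟩, h3⟩
      have hz : 0 < z.1 := hl.trans_le h1.1
      refine ⟨h1, h2, ?_⟩
      rwa [phaseNullcline, le_div_iff₀ (by positivity)]
  rw [this]
  exact (isCompact_Icc.prod isCompact_Icc).inter_right (isClosed_le (by fun_prop) (by fun_prop))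

lemma continuousOn_phaseSlope :
    ContinuousOn (fun z : ℝ × ℝ => phaseSlope a b z.1 z.2) {z | 0 < z.1 ∧ z.1 * z.2 < 1} := by
  unfold phaseSlope
  apply ContinuousOn.div (by fun_prop) (by fun_prop)
  rintro z ⟨h1, h2⟩
  have : 0 < 1 - z.1 * z.2 := by linarith
  positivity

lemma phaseRegion_subset (ha : 0 < a) (hb : 0 < b) {l r : ℝ} (hl : 0 < l) (hr : r < 1) :
    {z : ℝ × ℝ | z.1 ∈ Icc l r ∧ z.2 ∈ Icc 1 (phaseNullcline a b z.1)} ⊆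
      {z | 0 < z.1 ∧ z.1 * z.2 < 1} := by
  rintro z ⟨h1, h2⟩
  have hz : 0 < z.1 := hl.trans_le h1.1
  exact ⟨hz, mul_lt_one_of_le_phaseNullcline ha hb ⟨hz, h1.2.trans_lt hr⟩ h2.2⟩

lemma exists_phaseSlope_bound (ha : 0 < a) (hb : 0 < b) {l r : ℝ} (hl : 0 < l) (hr : r < 1) :
    ∃ C : NNReal, ∀ x ∈ Icc l r, ∀ p ∈ Icc 1 (phaseNullcline a b x), ‖phaseSlope a b x p‖ ≤ C := by
  obtain ⟨C, hC⟩ := (isCompact_phaseRegion ha hb (r := r) hl).exists_bound_of_continuousOn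
    (continuousOn_phaseSlope.mono (phaseRegion_subset ha hb hl hr))
  exact ⟨C.toNNReal, fun x hx p hp => (hC (x, p) ⟨hx, hp⟩).trans (Real.le_coe_toNNReal C)⟩

lemma exists_phaseSlope_lipschitz (ha : 0 < a) (hb : 0 < b) {l r : ℝ} (hl : 0 < l) (hr : r < 1) :
    ∃ K : NNReal, ∀ x ∈ Icc l r,
      LipschitzOnWith K (phaseSlope a b x) (Icc 1 (phaseNullcline a b x)) := by
  -- `D` is the partial derivative of the slope in p; a bound for it on the compact region is a
  -- Lipschitz constant uniform in x.
  let D : ℝ × ℝ → ℝ := fun z =>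
    (((a + (1 + b) * z.1) * z.2 - (a + 1 + b) + z.2 * (a + (1 + b) * z.1)) *
      (2 * z.1 * (1 - z.1 * z.2)) - (z.2 * ((a + (1 + b) * z.1) * z.2 - (a + 1 + b))) *
        (2 * z.1 * (-z.1))) / (2 * z.1 * (1 - z.1 * z.2)) ^ 2
  have hD : ContinuousOn D {z | 0 < z.1 ∧ z.1 * z.2 < 1} := by
    apply ContinuousOn.div (by fun_prop) (by fun_prop)
    rintro z ⟨h1, h2⟩
    have : 0 < 1 - z.1 * z.2 := by linarith
    positivity
  obtain ⟨C, hC⟩ := (isCompact_phaseRegion ha hb (r := r) hl).exists_bound_of_continuousOn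
    (hD.mono (phaseRegion_subset ha hb hl hr))
  refine ⟨C.toNNReal, fun x hx => ?_⟩
  refine (convex_Icc _ _).lipschitzOnWith_of_nnnorm_hasDerivWithin_le (f' := fun p => D (x, p))
    (fun p hp => ?_) (fun p hp => ?_)
  · obtain ⟨h1, h2⟩ := phaseRegion_subset ha hb hl hr (show (x, p) ∈ _ from ⟨hx, hp⟩)
    simp only at h1 h2
    have h3 : 0 < 1 - x * p := by linarith
    have h4 : 2 * x * (1 - x * p) ≠ 0 := by positivity
    have e1 : HasDerivAt (fun p : ℝ => (a + (1 + b) * x) * p - (a + 1 + b)) (a + (1 + b) * x) p := by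
      simpa using ((hasDerivAt_id p).const_mul (a + (1 + b) * x)).sub_const (a + 1 + b)
    have e2 : HasDerivAt (fun p : ℝ => 2 * x * (1 - x * p)) (2 * x * (-x)) p := by
      simpa using (((hasDerivAt_id p).const_mul x).const_sub 1).const_mul (2 * x)
    have := ((hasDerivAt_id p).mul e1).div e2 h4
    refine (this.congr_deriv ?_).hasDerivWithinAt
    simp [D]
  · have := (hC (x, p) ⟨hx, hp⟩).trans (Real.le_coe_toNNReal C)
    exact_mod_cast this

/-- Solutions issuing from the lower edge of the phase region stay in it to the left. -/
lemma exists_phase_solution (ha : 0 < a) (hb : 0 < b) {l r : ℝ} (hl : 0 < l) (hlr : l ≤ r)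
    (hr : r < 1) :
    ∃ f : ℝ → ℝ, f r = 1 ∧ ∀ x ∈ Icc l r, f x ∈ Icc 1 (phaseNullcline a b x) ∧
      HasDerivWithinAt f (phaseSlope a b x (f x)) (Icc l r) x := by
  obtain ⟨C, hC⟩ := exists_phaseSlope_bound ha hb hl hr
  obtain ⟨K, hK⟩ := exists_phaseSlope_lipschitz ha hb hl hr
  have hIoo : ∀ {x}, x ∈ Icc l r → x ∈ Ioo (0 : ℝ) 1 :=
    fun hx => ⟨hl.trans_le hx.1, hx.2.trans_lt hr⟩
  -- Clamping p to the region makes the field globally bounded and Lipschitz, so one Picard–Lindelöf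
  -- step covers all of `[l, r]`; the clamp is later shown to be inactive.
  let cl : ℝ → ℝ → ℝ := fun x p => max 1 (min p (phaseNullcline a b x))
  have hcl : ∀ x ∈ Icc l r, ∀ p, cl x p ∈ Icc 1 (phaseNullcline a b x) := fun x hx p =>
    ⟨le_max_left _ _, max_le (one_le_phaseNullcline ha hb (hIoo hx)).le (min_le_right _ _)⟩
  have hpl : IsPicardLindelof (fun x p => phaseSlope a b x (cl x p))
      (⟨r, hlr, le_rfl⟩ : Icc l r) 1 (C * (r - l).toNNReal) 0 C K := by
    refine ⟨fun x hx => ?_, fun p _ => ?_, fun x hx p _ => hC x hx _ (hcl x hx p), ?_⟩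
    · have h1 : LipschitzWith 1 (cl x) := (LipschitzWith.id.min_const _).const_max _
      have h2 := (hK x hx).comp h1.lipschitzOnWith (s := Metric.closedBall 1 (C * (r - l).toNNReal))
        (fun p _ => hcl x hx p)
      rw [mul_one] at h2
      exact h2
    · have h1 : ContinuousOn (fun x => cl x p) (Icc l r) := by
        apply continuousOn_const.sup
        apply continuousOn_const.inf
        exact fun x hx =>
          (hasDerivAt_phaseNullcline ha hb (hIoo hx).1).continuousAt.continuousWithinAt
      exact continuousOn_phaseSlope.comp (continuousOn_id.prodMk h1)
        (fun x hx => phaseRegion_subset ha hb hl hr ⟨hx, hcl x hx p⟩)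
    · simp [Real.coe_toNNReal _ (sub_nonneg.2 hlr), hlr]
  obtain ⟨f, hf1, hf⟩ := hpl.exists_eq_forall_mem_Icc_hasDerivWithinAt₀
  simp only at hf1 hf
  have hfc : ContinuousOn f (Icc l r) := fun x hx => (hf x hx).continuousWithinAt
  have hanti : AntitoneOn f (Icc l r) := by
    apply antitoneOn_of_hasDerivWithinAt_nonpos (convex_Icc l r) hfc
      (f' := fun x => phaseSlope a b x (cl x (f x)))
    · intro x hx
      exact (hf x (interior_subset hx)).mono interior_subset
    · intro x hx
      exact phaseSlope_nonpos ha hb (hIoo (interior_subset hx)) (hcl x (interior_subset hx) _)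
  have hlow : ∀ x ∈ Icc l r, 1 ≤ f x := fun x hx => by
    have := hanti hx (right_mem_Icc.2 hlr) hx.2
    rwa [hf1] at this
  have hup : ∀ x ∈ Icc l r, f x ≤ phaseNullcline a b x := by
    intro x hx
    by_contra! hlt
    have hsub : Icc x r ⊆ Icc l r := Icc_subset_Icc_left hx.1
    -- Wherever the solution meets the nullcline its slope is 0 while the nullcline strictly
    -- decreases. A solution above it at x would thus stay above up to r, where its value 1 is below
    -- the nullcline.
    have := image_le_of_deriv_right_lt_deriv_boundary' (a := x) (b := r)
      (f := phaseNullcline a b) (B := f)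
      (fun y hy => (hasDerivAt_phaseNullcline ha hb
        (hIoo (hsub hy)).1).continuousAt.continuousWithinAt)
      (fun y hy => (hasDerivAt_phaseNullcline ha hb
        (hIoo (hsub (Ico_subset_Icc_self hy))).1).hasDerivWithinAt)
      hlt.le (hfc.mono hsub)
      (fun y hy => ((hf y (hsub (Ico_subset_Icc_self hy))).mono hsub).mono_of_mem_nhdsWithin
        (Icc_mem_nhdsGE_of_mem hy)) (fun y hy hyf => by
          have hy' := hIoo (hsub (Ico_subset_Icc_self hy))
          have hy0 := hy'.1
          have : cl y (f y) = phaseNullcline a b y := by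
            simp only [cl, ← hyf, min_self]
            exact max_eq_right (one_le_phaseNullcline ha hb hy').le
          rw [this, phaseSlope_phaseNullcline ha hb hy0]
          apply div_neg_of_neg_of_pos
          · have : 0 < (a + 1 + b) * (1 + b) := by positivity
            linarith
          · positivity)
      (right_mem_Icc.2 hx.2)
    rw [hf1] at this
    exact absurd this (not_le.2 (one_le_phaseNullcline ha hb (hIoo (right_mem_Icc.2 hlr))))
  refine ⟨f, hf1, fun x hx => ⟨⟨hlow x hx, hup x hx⟩, ?_⟩⟩
  have : cl x (f x) = f x := by
    simp only [cl, min_eq_left (hup x hx), max_eq_right (hlow x hx)]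
  simpa [this] using hf x hx

/-- Ordered terminal values give ordered solutions in the phase region. -/
lemma phase_solution_le (ha : 0 < a) (hb : 0 < b) {l r : ℝ} (hl : 0 < l) (hr : r < 1) {f g : ℝ → ℝ}
    (hf : ∀ x ∈ Icc l r, f x ∈ Icc 1 (phaseNullcline a b x) ∧
      HasDerivWithinAt f (phaseSlope a b x (f x)) (Icc l r) x)
    (hg : ∀ x ∈ Icc l r, g x ∈ Icc 1 (phaseNullcline a b x) ∧
      HasDerivWithinAt g (phaseSlope a b x (g x)) (Icc l r) x)
    (hfg : f r ≤ g r) {x : ℝ} (hx : x ∈ Icc l r) : f x ≤ g x := by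
  by_contra! hlt
  obtain ⟨K, hK⟩ := exists_phaseSlope_lipschitz ha hb hl hr
  have hfc : ContinuousOn f (Icc l r) := fun x hx => (hf x hx).2.continuousWithinAt
  have hgc : ContinuousOn g (Icc l r) := fun x hx => (hg x hx).2.continuousWithinAt
  have hsub : Icc x r ⊆ Icc l r := Icc_subset_Icc_left hx.1
  -- If the order fails at x, the solutions meet at some y to its right; uniqueness leftwards from y
  -- forces equality at x.
  obtain ⟨y, hy, hy0⟩ := intermediate_value_Icc' hx.2 ((hfc.sub hgc).mono hsub)
    (show (0 : ℝ) ∈ Icc _ _ from ⟨sub_nonpos.2 hfg, sub_nonneg.2 hlt.le⟩)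
  have hyl : y ∈ Icc l r := hsub hy
  have hsub' : Icc x y ⊆ Icc l r := Icc_subset_Icc hx.1 hy.2
  have hd : ∀ {h : ℝ → ℝ} {h' t : ℝ}, t ∈ Ioc x y → HasDerivWithinAt h h' (Icc l r) t →
      HasDerivWithinAt h h' (Iic t) t := fun ht hh =>
    hh.mono_of_mem_nhdsWithin (Icc_mem_nhdsLE_of_mem ⟨hx.1.trans_lt ht.1, ht.2.trans hy.2⟩)
  have heq := ODE_solution_unique_of_mem_Icc_left (a := x) (b := y) (v := phaseSlope a b)
    (s := fun t => Icc 1 (phaseNullcline a b t))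
    (fun t ht => hK t (hsub' (Ioc_subset_Icc_self ht)))
    (hfc.mono hsub') (fun t ht => hd ht (hf t (hsub' (Ioc_subset_Icc_self ht))).2)
    (fun t ht => (hf t (hsub' (Ioc_subset_Icc_self ht))).1)
    (hgc.mono hsub') (fun t ht => hd ht (hg t (hsub' (Ioc_subset_Icc_self ht))).2)
    (fun t ht => (hg t (hsub' (Ioc_subset_Icc_self ht))).1) (sub_eq_zero.1 hy0)
    (left_mem_Icc.2 hy.1)
  exact absurd heq (ne_of_gt hlt)

end Phase

/-! ### Construction of the connecting orbit -/

section PhaseCurve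

variable {a b : ℝ}

lemma intervalIntegral_eq_sub_of_phase_solution (ha : 0 < a) (hb : 0 < b) {l r : ℝ} (hl : 0 < l)
    (hlr : l ≤ r) (hr : r < 1) {f : ℝ → ℝ}
    (hf : ∀ x ∈ Icc l r, f x ∈ Icc 1 (phaseNullcline a b x) ∧
      HasDerivWithinAt f (phaseSlope a b x (f x)) (Icc l r) x) :
    ∫ t in l..r, phaseSlope a b t (f t) = f r - f l := by
  have hfc : ContinuousOn f (Icc l r) := fun x hx => (hf x hx).2.continuousWithinAt
  refine intervalIntegral.integral_eq_sub_of_hasDerivAt_of_le hlr hfc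
    (fun x hx => (hf x (Ioo_subset_Icc_self hx)).2.hasDerivAt (Icc_mem_nhds hx.1 hx.2)) ?_
  apply ContinuousOn.intervalIntegrable_of_Icc hlr
  exact continuousOn_phaseSlope.comp (continuousOn_id.prodMk hfc)
    (fun x hx => phaseRegion_subset ha hb hl hr ⟨hx, (hf x hx).1⟩)

/-- A pointwise limit of solutions in the phase region is a solution. -/
lemma hasDerivAt_of_tendsto_phase_solution (ha : 0 < a) (hb : 0 < b) {f : ℕ → ℝ → ℝ} {p : ℝ → ℝ}
    (hf : ∀ l r, 0 < l → r < 1 → ∀ᶠ k in atTop, ∀ x ∈ Icc l r,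
      f k x ∈ Icc 1 (phaseNullcline a b x) ∧
      HasDerivWithinAt (f k) (phaseSlope a b x (f k x)) (Icc l r) x)
    (hp : ∀ x ∈ Ioo (0 : ℝ) 1, Tendsto (fun k => f k x) atTop (𝓝 (p x)))
    {x : ℝ} (hx : x ∈ Ioo (0 : ℝ) 1) :
    p x ∈ Icc 1 (phaseNullcline a b x) ∧ HasDerivAt p (phaseSlope a b x (p x)) x := by
  have hmem : ∀ x ∈ Ioo (0 : ℝ) 1, p x ∈ Icc 1 (phaseNullcline a b x) := fun x hx =>
    isClosed_Icc.mem_of_tendsto (hp x hx) ((hf x x hx.1 hx.2).mono fun k hk => (hk x (by simp)).1)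
  have hsub : ∀ {l r : ℝ}, 0 < l → r < 1 → Icc l r ⊆ Ioo (0 : ℝ) 1 := fun hl hr t ht =>
    ⟨hl.trans_le ht.1, ht.2.trans_lt hr⟩
  -- The limit is taken in the integral equation, by dominated convergence. The identity makes p
  -- Lipschitz, hence the integrand continuous, and the fundamental theorem of calculus restores the
  -- differential equation.
  have hint : ∀ l r, 0 < l → l ≤ r → r < 1 →
      ∫ t in l..r, phaseSlope a b t (p t) = p r - p l := by
    intro l r hl hlr hr
    obtain ⟨C, hC⟩ := exists_phaseSlope_bound ha hb hl hr
    have h1 : Tendsto (fun k => ∫ t in l..r, phaseSlope a b t (f k t)) atTop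
        (𝓝 (∫ t in l..r, phaseSlope a b t (p t))) := by
      apply intervalIntegral.tendsto_integral_filter_of_dominated_convergence (fun _ => (C : ℝ))
      · filter_upwards [hf l r hl hr] with k hk
        rw [uIoc_of_le hlr]
        have hfc : ContinuousOn (f k) (Icc l r) := fun x hx => (hk x hx).2.continuousWithinAt
        have : ContinuousOn (fun t => phaseSlope a b t (f k t)) (Icc l r) :=
          continuousOn_phaseSlope.comp (continuousOn_id.prodMk hfc)
            (fun x hx => phaseRegion_subset ha hb hl hr ⟨hx, (hk x hx).1⟩)
        exact (this.mono Ioc_subset_Icc_self).aestronglyMeasurable measurableSet_Ioc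
      · filter_upwards [hf l r hl hr] with k hk
        refine .of_forall fun t ht => ?_
        rw [uIoc_of_le hlr] at ht
        have ht' := Ioc_subset_Icc_self ht
        exact hC t ht' _ (hk t ht').1
      · exact intervalIntegrable_const
      · refine .of_forall fun t ht => ?_
        rw [uIoc_of_le hlr] at ht
        have ht' := hsub hl hr (Ioc_subset_Icc_self ht)
        have hc : ContinuousAt (fun z : ℝ × ℝ => phaseSlope a b z.1 z.2) (t, p t) := by
          apply continuousOn_phaseSlope.continuousAt
          apply IsOpen.mem_nhds
          · exact (isOpen_lt continuous_const continuous_fst).inter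
              (isOpen_lt (continuous_fst.mul continuous_snd) continuous_const)
          · exact ⟨ht'.1, mul_lt_one_of_le_phaseNullcline ha hb ht' (hmem t ht').2⟩
        exact hc.tendsto.comp (tendsto_const_nhds.prodMk_nhds (hp t ht'))
    have h2 : Tendsto (fun k => ∫ t in l..r, phaseSlope a b t (f k t)) atTop
        (𝓝 (p r - p l)) := by
      have h3 := (hp r (hsub hl hr (right_mem_Icc.2 hlr))).sub
        (hp l (hsub hl hr (left_mem_Icc.2 hlr)))
      refine h3.congr' ?_
      filter_upwards [hf l r hl hr] with k hk
      exact (intervalIntegral_eq_sub_of_phase_solution ha hb hl hlr hr hk).symm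
    exact tendsto_nhds_unique h1 h2
  have hcont : ∀ l r, 0 < l → r < 1 → ContinuousOn p (Icc l r) := by
    intro l r hl hr
    obtain ⟨C, hC⟩ := exists_phaseSlope_bound ha hb hl hr
    have hle : ∀ x ∈ Icc l r, ∀ y ∈ Icc l r, x ≤ y → |p y - p x| ≤ C * |y - x| := by
      intro x hx y hy hxy
      rw [← hint x y (hl.trans_le hx.1) hxy (hy.2.trans_lt hr), ← Real.norm_eq_abs]
      refine intervalIntegral.norm_integral_le_of_norm_le_const fun t ht => ?_
      rw [uIoc_of_le hxy] at ht
      have ht' : t ∈ Icc l r := ⟨hx.1.trans ht.1.le, ht.2.trans hy.2⟩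
      exact hC t ht' _ (hmem t (hsub hl hr ht'))
    have : LipschitzOnWith C p (Icc l r) := LipschitzOnWith.of_dist_le_mul fun x hx y hy => by
      rw [Real.dist_eq, Real.dist_eq]
      rcases le_total x y with h | h
      · rw [abs_sub_comm, abs_sub_comm x]
        exact hle x hx y hy h
      · exact hle y hy x hx h
    exact this.continuousOn
  refine ⟨hmem x hx, ?_⟩
  obtain ⟨l, hl, hlx⟩ := exists_between hx.1
  obtain ⟨r, hxr, hr⟩ := exists_between hx.2
  have hslope : ContinuousOn (fun t => phaseSlope a b t (p t)) (Icc l r) :=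
    continuousOn_phaseSlope.comp (continuousOn_id.prodMk (hcont l r hl hr))
      (fun x hx => phaseRegion_subset ha hb hl hr ⟨hx, hmem x (hsub hl hr hx)⟩)
  have hderiv : HasDerivAt (fun y => ∫ t in l..y, phaseSlope a b t (p t))
      (phaseSlope a b x (p x)) x := by
    apply intervalIntegral.integral_hasDerivAt_right
    · exact (hslope.mono (Icc_subset_Icc_right hxr.le)).intervalIntegrable_of_Icc hlx.le
    · exact (hslope.mono Ioo_subset_Icc_self).stronglyMeasurableAtFilter isOpen_Ioo x ⟨hlx, hxr⟩
    · exact hslope.continuousAt (Icc_mem_nhds hlx hxr)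
  refine (hderiv.const_add (p l)).congr_of_eventuallyEq ?_
  filter_upwards [Ioo_mem_nhds hlx hxr] with y hy
  rw [hint l y hl hy.1.le (hy.2.trans hr)]
  ring

/-- The orbit of the phase equation on `(0, 1)` joining the node `(0, (a + 1 + b) / a)` to the
saddle `(1, 1)`. -/
lemma exists_phase_curve (ha : 0 < a) (hb : 0 < b) :
    ∃ p : ℝ → ℝ, ∀ x ∈ Ioo (0 : ℝ) 1, p x ∈ Icc 1 (phaseNullcline a b x) ∧
      HasDerivAt p (phaseSlope a b x (p x)) x := by
  let l : ℕ → ℝ := fun k => 1 / ((k : ℝ) + 2)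
  have hl : ∀ k, 0 < l k := fun k => by positivity
  have hl2 : ∀ k, l k ≤ 1 / 2 := fun k => by
    apply one_div_le_one_div_of_le (by norm_num)
    have : (0 : ℝ) ≤ k := k.cast_nonneg
    linarith
  have hanti : Antitone l := fun j k hjk => by
    apply one_div_le_one_div_of_le (by positivity)
    gcongr
  have hl0 : Tendsto l atTop (𝓝 0) :=
    tendsto_const_nhds.div_atTop (tendsto_natCast_atTop_atTop.atTop_add tendsto_const_nhds)
  choose f hf1 hf using fun k => exists_phase_solution ha hb (l := l k) (r := 1 - l k) (hl k)
    (by linarith [hl2 k]) (by linarith [hl k])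
  classical
  -- The filler value 1 is the lower edge of the region, so monotonicity in k also holds at points
  -- not yet covered.
  let g : ℕ → ℝ → ℝ := fun k x => if x ∈ Icc (l k) (1 - l k) then f k x else 1
  have hg1 : ∀ k, ∀ x ∈ Ioo (0 : ℝ) 1, g k x ∈ Icc 1 (phaseNullcline a b x) := by
    intro k x hx
    simp only [g]
    split_ifs with h
    · exact (hf k x h).1
    · exact ⟨le_rfl, (one_le_phaseNullcline ha hb hx).le⟩
  have hgf : ∀ k x, x ∈ Icc (l k) (1 - l k) → g k x = f k x := fun k x hx => if_pos hx
  have hmono : ∀ x ∈ Ioo (0 : ℝ) 1, Monotone (fun k => g k x) := by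
    intro x hx j k hjk
    by_cases h : x ∈ Icc (l j) (1 - l j)
    · have hsub : Icc (l j) (1 - l j) ⊆ Icc (l k) (1 - l k) :=
        Icc_subset_Icc (hanti hjk) (by linarith [hanti hjk])
      have hr : 1 - l j ∈ Icc (l j) (1 - l j) := ⟨by linarith [hl2 j], le_rfl⟩
      simp only [hgf j x h, hgf k x (hsub h)]
      refine phase_solution_le ha hb (hl j) (by linarith [hl j]) (hf j)
        (fun t ht => ⟨(hf k t (hsub ht)).1, (hf k t (hsub ht)).2.mono hsub⟩) ?_ h
      rw [hf1 j]
      exact (hf k _ (hsub hr)).1.1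
    · simp only [g, if_neg h]
      exact (hg1 k x hx).1
  refine ⟨fun x => ⨆ k, g k x, fun x hx => hasDerivAt_of_tendsto_phase_solution ha hb (f := g)
    (fun s t hs ht => ?_) (fun x hx => tendsto_atTop_ciSup (hmono x hx) ?_) hx⟩
  · filter_upwards [hl0.eventually_lt_const hs, hl0.eventually_lt_const (sub_pos.2 ht)]
      with k h1 h2 x hx
    have hsub : Icc s t ⊆ Icc (l k) (1 - l k) := Icc_subset_Icc h1.le (by linarith)
    rw [hgf k x (hsub hx)]
    refine ⟨(hf k x (hsub hx)).1, ?_⟩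
    exact ((hf k x (hsub hx)).2.mono hsub).congr (fun y hy => hgf k y (hsub hy))
      (hgf k x (hsub hx))
  · exact ⟨phaseNullcline a b x, by rintro _ ⟨k, rfl⟩; exact (hg1 k x hx).2⟩

end PhaseCurve

/-! ### Rate of approach to the node -/

/-- If `d' ≥ γ d / x - C` on `(0, r]`, then `d = O(x ^ γ)` from above. -/
lemma exists_le_mul_rpow_of_deriv_ge {d d' : ℝ → ℝ} {γ C r : ℝ} (hγ : γ < 1) (hC : 0 ≤ C)
    (hr : 0 < r) (hd : ∀ x ∈ Ioc 0 r, HasDerivAt d (d' x) x)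
    (hle : ∀ x ∈ Ioc 0 r, γ * d x / x - C ≤ d' x) :
    ∃ K, ∀ x ∈ Ioc 0 r, d x ≤ K * x ^ γ := by
  -- The integrating factor `x ^ (-γ)` absorbs the singular term; the second summand compensates the
  -- constant `C` and is bounded near 0 because γ < 1.
  let e : ℝ → ℝ := fun x => d x * x ^ (-γ) + C / (1 - γ) * x ^ (1 - γ)
  have hγ' : 0 < 1 - γ := by linarith
  have he : ∀ x ∈ Ioc 0 r, HasDerivAt e (x ^ (-γ) * (d' x - γ * d x / x + C)) x := by
    intro x hx
    have h0 : x ≠ 0 := hx.1.ne'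
    have := ((hd x hx).mul (Real.hasDerivAt_rpow_const (p := -γ) (Or.inl h0))).add
      ((Real.hasDerivAt_rpow_const (p := 1 - γ) (Or.inl h0)).const_mul (C / (1 - γ)))
    refine this.congr_deriv ?_
    rw [show (1 - γ - 1) = -γ by ring, Real.rpow_sub_one h0]
    field_simp
    ring
  have hmono : MonotoneOn e (Ioc 0 r) := by
    apply monotoneOn_of_hasDerivWithinAt_nonneg (convex_Ioc 0 r)
      (fun x hx => (he x hx).continuousAt.continuousWithinAt)
      (fun x hx => (he x (interior_subset hx)).hasDerivWithinAt)
    intro x hx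
    have hx' := interior_subset hx
    have := hle x hx'
    exact mul_nonneg (Real.rpow_nonneg hx'.1.le _) (by linarith)
  refine ⟨e r, fun x hx => ?_⟩
  have h1 := hmono hx (right_mem_Ioc.2 hr) hx.2
  have h2 : d x * x ^ (-γ) ≤ e r := by
    refine le_trans ?_ h1
    have : 0 ≤ C / (1 - γ) * x ^ (1 - γ) :=
      mul_nonneg (div_nonneg hC hγ'.le) (Real.rpow_nonneg hx.1.le _)
    simp only [e]
    linarith
  have h3 : 0 < x ^ γ := Real.rpow_pos_of_pos hx.1 _
  rw [Real.rpow_neg hx.1.le] at h2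
  calc d x = d x * (x ^ γ)⁻¹ * x ^ γ := by field_simp
    _ ≤ e r * x ^ γ := by gcongr

section PhaseRate

variable {a b : ℝ} {p : ℝ → ℝ}

/-- With c = (a+1+b)/a, the negated slope splits into a singular part (pa/2)(c - p)/x, divided by 1
- xp ≤ 1, and a part bounded because xp ≤ 1/2. This is the differential inequality for the defect c
- p. -/
lemma neg_phaseSlope_ge (ha : 0 < a) (hb : 0 < b) {x p γ : ℝ} (hx : 0 < x)
    (hx' : x * ((a + 1 + b) / a) ≤ 1 / 2) (hp : 1 ≤ p) (hp' : p ≤ (a + 1 + b) / a)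
    (hγ : γ ≤ p * a / 2) :
    γ * ((a + 1 + b) / a - p) / x - (1 + b) * ((a + 1 + b) / a) ^ 2 ≤ -phaseSlope a b x p := by
  obtain ⟨c, hc⟩ : ∃ c, c = (a + 1 + b) / a := ⟨_, rfl⟩
  have hac : a + 1 + b = a * c := by rw [hc]; field_simp
  rw [phaseSlope, ← hc, hac]
  rw [← hc] at hx' hp'
  have h1 : x * p ≤ 1 / 2 := (mul_le_mul_of_nonneg_left hp' hx.le).trans hx'
  have h1' : 0 ≤ x * p := by positivity
  have h2 : 0 < 1 - x * p := by linarith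
  have hd : 0 ≤ c - p := by linarith
  have e : -(p * ((a + (1 + b) * x) * p - a * c) / (2 * x * (1 - x * p))) =
      (p * a / 2 * (c - p) / x) / (1 - x * p) - (1 + b) * p ^ 2 * (1 / (2 * (1 - x * p))) := by
    field_simp
    ring
  rw [e]
  have h3 : γ * (c - p) / x ≤ (p * a / 2 * (c - p) / x) / (1 - x * p) := by
    rw [le_div_iff₀ h2]
    have h4 : 0 ≤ p * a / 2 * (c - p) / x := by positivity
    have h5 : γ * (c - p) / x ≤ p * a / 2 * (c - p) / x := by gcongr
    calc γ * (c - p) / x * (1 - x * p) ≤ (p * a / 2 * (c - p) / x) * (1 - x * p) := by gcongr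
      _ ≤ _ := by nlinarith
  have h6 : 1 / (2 * (1 - x * p)) ≤ 1 := by
    rw [div_le_one (by positivity)]
    linarith
  have h7 : (1 + b) * p ^ 2 * (1 / (2 * (1 - x * p))) ≤ (1 + b) * c ^ 2 * 1 := by gcongr
  linarith

lemma tendsto_mul_const_zero_right (c : ℝ) : Tendsto (fun x : ℝ => x * c) (𝓝[>] 0) (𝓝 0) := by
  have : Tendsto (fun x : ℝ => x * c) (𝓝 0) (𝓝 (0 * c)) :=
    (continuous_id.mul continuous_const).tendsto 0
  rw [zero_mul] at this
  exact this.mono_left nhdsWithin_le_nhds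

lemma phase_curve_rate_aux (ha : 0 < a) (hb : 0 < b)
    (hp : ∀ x ∈ Ioo (0 : ℝ) 1, p x ∈ Icc 1 (phaseNullcline a b x) ∧
      HasDerivAt p (phaseSlope a b x (p x)) x) {γ : ℝ} (hγ1 : γ < 1)
    (hγ : ∀ᶠ x in 𝓝[>] 0, γ ≤ p x * a / 2) :
    ∃ K, ∀ᶠ x in 𝓝[>] 0, |p x - (a + 1 + b) / a| ≤ K * x ^ γ := by
  have h1 := (tendsto_mul_const_zero_right ((a + 1 + b) / a)).eventually_le_const
    (show (0 : ℝ) < 1 / 2 by norm_num)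
  obtain ⟨r, hr, hr'⟩ := mem_nhdsGT_iff_exists_Ioo_subset.1 ((h1.and hγ).and
    (Ioo_mem_nhdsGT (show (0 : ℝ) < 1 by norm_num)))
  have hr0 : 0 < r := hr
  have hsub : ∀ x ∈ Ioc 0 (r / 2), x ∈ Ioo 0 r := fun x hx => ⟨hx.1, by linarith [hx.2]⟩
  have hpc : ∀ x ∈ Ioo 0 r, p x ≤ (a + 1 + b) / a := fun x hx =>
    ((hp x (hr' hx).2).1.2).trans (phaseNullcline_le ha hb hx.1.le)
  obtain ⟨K, hK⟩ := exists_le_mul_rpow_of_deriv_ge (d := fun x => (a + 1 + b) / a - p x)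
    (d' := fun x => -phaseSlope a b x (p x)) (C := (1 + b) * ((a + 1 + b) / a) ^ 2) hγ1
    (by positivity) (half_pos hr0)
    (fun x hx => (hp x (hr' (hsub x hx)).2).2.const_sub _)
    (fun x hx => neg_phaseSlope_ge ha hb hx.1 (hr' (hsub x hx)).1.1
      (hp x (hr' (hsub x hx)).2).1.1 (hpc x (hsub x hx)) (hr' (hsub x hx)).1.2)
  refine ⟨K, ?_⟩
  filter_upwards [Ioc_mem_nhdsGT (half_pos hr0)] with x hx
  rw [abs_sub_comm, abs_of_nonneg (by linarith [hpc x (hsub x hx)])]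
  exact hK x hx

lemma tendsto_of_abs_sub_le_mul_rpow {f : ℝ → ℝ} {c K γ : ℝ} (hγ : 0 < γ)
    (h : ∀ᶠ x in 𝓝[>] (0 : ℝ), |f x - c| ≤ K * x ^ γ) : Tendsto f (𝓝[>] 0) (𝓝 c) := by
  rw [tendsto_iff_norm_sub_tendsto_zero]
  have h1 : Tendsto (fun x : ℝ => K * x ^ γ) (𝓝[>] 0) (𝓝 0) := by
    have : Tendsto (fun x : ℝ => K * x ^ γ) (𝓝 0) (𝓝 (K * 0 ^ γ)) :=
      ((Real.continuousAt_rpow_const 0 γ (Or.inr hγ.le)).tendsto).const_mul K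
    rw [Real.zero_rpow hγ.ne', mul_zero] at this
    exact this.mono_left nhdsWithin_le_nhds
  exact squeeze_zero' (.of_forall fun x => norm_nonneg _) h h1

/-- The orbit leaves the node `(0, (a + 1 + b) / a)` faster than `√x`. -/
lemma exists_phase_curve_rate (ha : 0 < a) (hb : 0 < b)
    (hp : ∀ x ∈ Ioo (0 : ℝ) 1, p x ∈ Icc 1 (phaseNullcline a b x) ∧
      HasDerivAt p (phaseSlope a b x (p x)) x) :
    ∃ γ > (1 / 2 : ℝ), ∃ K, ∀ᶠ x in 𝓝[>] 0, |p x - (a + 1 + b) / a| ≤ K * x ^ γ := by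
  -- Bootstrap: the crude bound p ≥ 1 allows only an exponent up to a/2, but that already gives p →
  -- c.
  obtain ⟨K, hK⟩ := phase_curve_rate_aux ha hb hp (γ := min (a / 2) (1 / 2))
    ((min_le_right _ _).trans_lt (by norm_num)) (by
      filter_upwards [Ioo_mem_nhdsGT (show (0 : ℝ) < 1 by norm_num)] with x hx
      refine (min_le_left _ _).trans ?_
      nlinarith [(hp x hx).1.1])
  have hlim : Tendsto p (𝓝[>] 0) (𝓝 ((a + 1 + b) / a)) :=
    tendsto_of_abs_sub_le_mul_rpow (lt_min (half_pos ha) (by norm_num)) hK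
  -- Now pa/2 tends to ca/2 = (a+1+b)/2, the eigenvalue ratio at the node, which exceeds 1/2.
  obtain ⟨γ, hγ1, hγ2⟩ := exists_between (show (1 / 2 : ℝ) < min 1 ((a + 1 + b) / 2) from
    lt_min (by norm_num) (by linarith))
  have hγ3 := hγ2.trans_le (min_le_right _ _)
  refine ⟨γ, hγ1, phase_curve_rate_aux ha hb hp (hγ2.trans_le (min_le_left _ _)) ?_⟩
  have h2 : Tendsto (fun x => p x * a / 2) (𝓝[>] 0) (𝓝 ((a + 1 + b) / a * a / 2)) :=
    (hlim.mul_const a).div_const 2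
  rw [div_mul_cancel₀ _ ha.ne'] at h2
  exact h2.eventually_const_le hγ3

end PhaseRate

/-! ### Inversion of the similarity variable and the stress quadrature -/

/-- An odd function on `(-1, 1)` with positive derivative and range unbounded above has an odd
inverse on `ℝ`. -/
lemma exists_odd_inverse {X X' : ℝ → ℝ} (hX : ∀ m ∈ Ioo (-1 : ℝ) 1, HasDerivAt X (X' m) m)
    (hpos : ∀ m ∈ Ioo (-1 : ℝ) 1, 0 < X' m) (hodd : ∀ m, X (-m) = -X m)
    (htop : ∀ B, ∃ m ∈ Ioo (0 : ℝ) 1, B ≤ X m) :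
    ∃ M : ℝ → ℝ, (∀ ξ, M ξ ∈ Ioo (-1 : ℝ) 1) ∧ (∀ ξ, X (M ξ) = ξ) ∧ (∀ ξ, M (-ξ) = -M ξ) ∧
      (∀ ξ, HasDerivAt M (X' (M ξ))⁻¹ ξ) ∧ Tendsto M atTop (𝓝 1) := by
  have hc : ContinuousOn X (Ioo (-1) 1) := fun m hm => (hX m hm).continuousAt.continuousWithinAt
  have hmono : StrictMonoOn X (Ioo (-1) 1) := by
    refine strictMonoOn_of_hasDerivWithinAt_pos (convex_Ioo _ _) hc
      (fun m hm => (hX m (interior_subset hm)).hasDerivWithinAt)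
      (fun m hm => hpos m (interior_subset hm))
  have hsurj : ∀ ξ, ∃ m ∈ Ioo (-1 : ℝ) 1, X m = ξ := by
    intro ξ
    obtain ⟨m, hm, hle⟩ := htop |ξ|
    have hm1 : m ∈ Ioo (-1 : ℝ) 1 := ⟨by linarith [hm.1], hm.2⟩
    have hm2 : -m ∈ Ioo (-1 : ℝ) 1 := ⟨by linarith [hm.2], by linarith [hm.1]⟩
    have hsub : Icc (-m) m ⊆ Ioo (-1) 1 := fun t ht =>
      ⟨hm2.1.trans_le ht.1, ht.2.trans_lt hm1.2⟩
    obtain ⟨t, ht, h⟩ := intermediate_value_Icc (by linarith [hm.1]) (hc.mono hsub)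
      (show ξ ∈ Icc (X (-m)) (X m) by
        rw [hodd]
        exact ⟨by linarith [neg_abs_le ξ], (le_abs_self ξ).trans hle⟩)
    exact ⟨t, hsub ht, h⟩
  choose M hM hXM using hsurj
  have hMX : ∀ m ∈ Ioo (-1 : ℝ) 1, M (X m) = m := fun m hm =>
    hmono.injOn (hM _) hm (hXM _)
  have hMmono : StrictMono M := fun x y hxy => by
    rw [← hmono.lt_iff_lt (hM x) (hM y), hXM, hXM]
    exact hxy
  have hMc : ∀ ξ, ContinuousAt M ξ := by
    intro ξ
    apply (hMmono.strictMonoOn univ).continuousAt_of_image_mem_nhds univ_mem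
    refine mem_of_superset (Ioo_mem_nhds (hM ξ).1 (hM ξ).2) fun m hm => ⟨X m, mem_univ _, hMX m hm⟩
  refine ⟨M, hM, hXM, fun ξ => ?_, fun ξ => ?_, ?_⟩
  · have := hM ξ
    have h1 : -M ξ ∈ Ioo (-1 : ℝ) 1 := ⟨by linarith [this.2], by linarith [this.1]⟩
    rw [← hMX _ h1, hodd, hXM]
  · exact (hX _ (hM ξ)).of_local_left_inverse (hMc ξ) (hpos _ (hM ξ)).ne' (.of_forall hXM)
  · rw [tendsto_order]
    refine ⟨fun l hl => ?_, fun l hl => .of_forall fun ξ => (hM ξ).2.trans hl⟩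
    obtain ⟨m, hm, hm1⟩ := exists_between (max_lt hl (show (-1 : ℝ) < 1 by norm_num))
    have hm' : m ∈ Ioo (-1 : ℝ) 1 := ⟨(le_max_right _ _).trans_lt hm, hm1⟩
    filter_upwards [eventually_ge_atTop (X m)] with ξ hξ
    have := hMmono.monotone hξ
    rw [hMX m hm'] at this
    exact ((le_max_left _ _).trans_lt hm).trans_le this

/-- An orbit of the phase equation joining the node to the saddle, extended to `x ≤ 0` by its value
at the node. -/
structure IsPhaseProfile (a b : ℝ) (p : ℝ → ℝ) : Prop where
  mem : ∀ x ∈ Ioo (0 : ℝ) 1, p x ∈ Icc 1 (phaseNullcline a b x)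
  hasDerivAt : ∀ x ∈ Ioo (0 : ℝ) 1, HasDerivAt p (phaseSlope a b x (p x)) x
  of_nonpos : ∀ x ≤ 0, p x = (a + 1 + b) / a
  continuousAt_zero : ContinuousAt p 0
  rate : Tendsto (fun m => (p (m ^ 2) - (a + 1 + b) / a) / m) (𝓝 0) (𝓝 0)

lemma exists_isPhaseProfile {a b : ℝ} (ha : 0 < a) (hb : 0 < b) : ∃ p, IsPhaseProfile a b p := by
  obtain ⟨p, hp⟩ := exists_phase_curve ha hb
  obtain ⟨γ, hγ, K, hK⟩ := exists_phase_curve_rate ha hb hp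
  have hlim := tendsto_of_abs_sub_le_mul_rpow (by linarith) hK
  let q : ℝ → ℝ := fun x => if x ≤ 0 then (a + 1 + b) / a else p x
  have hq : ∀ x, 0 < x → q x = p x := fun x hx => if_neg (not_le.2 hx)
  have hq0 : ∀ x ≤ 0, q x = (a + 1 + b) / a := fun x hx => if_pos hx
  refine ⟨q, ⟨fun x hx => ?_, fun x hx => ?_, hq0, ?_, ?_⟩⟩
  · rw [hq x hx.1]
    exact (hp x hx).1
  · rw [hq x hx.1]
    refine (hp x hx).2.congr_of_eventuallyEq ?_
    filter_upwards [Ioi_mem_nhds hx.1] with y hy using hq y hy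
  · rw [continuousAt_iff_continuous_left'_right']
    constructor
    · refine (continuousWithinAt_const (b := (a + 1 + b) / a)).congr (fun y hy => hq0 y hy.le)
        (hq0 0 le_rfl)
    · rw [ContinuousWithinAt, hq0 0 le_rfl]
      refine hlim.congr' ?_
      filter_upwards [self_mem_nhdsWithin] with y hy using (hq y hy).symm
  · have hγ' : 0 < 2 * γ - 1 := by linarith
    have h0 : Tendsto (fun m : ℝ => K * |m| ^ (2 * γ - 1)) (𝓝 0) (𝓝 0) := by
      have : ContinuousAt (fun m : ℝ => K * |m| ^ (2 * γ - 1)) 0 :=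
        continuousAt_const.mul (continuous_abs.continuousAt.rpow_const (Or.inr hγ'.le))
      simpa [ContinuousAt, Real.zero_rpow hγ'.ne'] using this
    have hsq : Tendsto (fun m : ℝ => m ^ 2) (𝓝[≠] 0) (𝓝[>] 0) := by
      rw [tendsto_nhdsWithin_iff]
      constructor
      · have : Tendsto (fun m : ℝ => m ^ 2) (𝓝 0) (𝓝 (0 ^ 2)) := (continuous_pow 2).tendsto 0
        rw [zero_pow two_ne_zero] at this
        exact this.mono_left nhdsWithin_le_nhds
      · filter_upwards [self_mem_nhdsWithin] with m hm
        have : m ≠ 0 := hm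
        exact mem_Ioi.2 (by positivity)
    have h1 : Tendsto (fun m => (q (m ^ 2) - (a + 1 + b) / a) / m) (𝓝[≠] 0) (𝓝 0) := by
      refine squeeze_zero_norm' ?_ (h0.mono_left nhdsWithin_le_nhds)
      filter_upwards [hsq.eventually hK, self_mem_nhdsWithin] with m hm hm0
      have hm0' : m ≠ 0 := hm0
      have hm1 : 0 < |m| := abs_pos.2 hm0'
      rw [hq _ (by positivity), norm_div, Real.norm_eq_abs, Real.norm_eq_abs, div_le_iff₀ hm1,
        mul_assoc, Real.rpow_sub_one hm1.ne', div_mul_cancel₀ _ hm1.ne', Real.rpow_mul hm1.le]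
      simpa [Real.rpow_two] using hm
    -- The quotient is 0 at m = 0 by the convention for division by zero, so the punctured limit is
    -- a full one.
    have h2 : ContinuousAt (fun m => (q (m ^ 2) - (a + 1 + b) / a) / m) 0 :=
      continuousAt_iff_punctured_nhds.2 (by rwa [div_zero])
    simpa only [ContinuousAt, div_zero] using h2

namespace IsPhaseProfile

variable {a b : ℝ} {p : ℝ → ℝ}

lemma one_le (h : IsPhaseProfile a b p) (ha : 0 < a) (hb : 0 < b) {x : ℝ} (hx : x < 1) :
    1 ≤ p x := by
  rcases le_or_gt x 0 with h0 | h0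
  · rw [h.of_nonpos x h0, one_le_div ha]
    linarith
  · exact (h.mem x ⟨h0, hx⟩).1

lemma mul_lt_one (h : IsPhaseProfile a b p) (ha : 0 < a) (hb : 0 < b) {x : ℝ} (hx : x < 1) :
    x * p x < 1 := by
  rcases le_or_gt x 0 with h0 | h0
  · nlinarith [h.one_le ha hb hx]
  · exact mul_lt_one_of_le_phaseNullcline ha hb ⟨h0, hx⟩ (h.mem x ⟨h0, hx⟩).2

lemma continuousAt (h : IsPhaseProfile a b p) {x : ℝ} (hx : x < 1) : ContinuousAt p x := by
  rcases lt_trichotomy x 0 with h0 | rfl | h0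
  · refine continuousAt_const.congr (f := fun _ => (a + 1 + b) / a) ?_
    filter_upwards [Iio_mem_nhds h0] with y hy using (h.of_nonpos y hy.le).symm
  · exact h.continuousAt_zero
  · exact (h.hasDerivAt x ⟨h0, hx⟩).continuousAt

lemma tendsto_one (h : IsPhaseProfile a b p) (ha : 0 < a) (hb : 0 < b) :
    Tendsto p (𝓝[<] 1) (𝓝 1) := by
  have h1 : Tendsto (phaseNullcline a b) (𝓝[<] 1) (𝓝 1) := by
    have := (hasDerivAt_phaseNullcline ha hb one_pos).continuousAt.tendsto
    rw [phaseNullcline, mul_one, ← add_assoc, div_self (by positivity)] at this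
    exact this.mono_left nhdsWithin_le_nhds
  refine tendsto_of_tendsto_of_tendsto_of_le_of_le' tendsto_const_nhds h1 ?_ ?_
  all_goals
    filter_upwards [Ioo_mem_nhdsLT (show (0 : ℝ) < 1 by norm_num)] with x hx
  · exact (h.mem x hx).1
  · exact (h.mem x hx).2

/-- The logarithm of the stress, normalised at the origin, as a function of `x = (ξ / S) ^ 2`. -/
lemma exists_logStress (h : IsPhaseProfile a b p) (ha : 0 < a) (hb : 0 < b) :
    ∃ H : ℝ → ℝ, H 0 = 0 ∧ (∀ x < 1, HasDerivAt H (p x / (2 * (1 - x * p x))) x) ∧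
      Tendsto H (𝓝[<] 1) atTop := by
  have hpos : ∀ x < 1, 0 < 1 - x * p x := fun x hx => by linarith [h.mul_lt_one ha hb hx]
  have hc : ContinuousOn (fun x => p x / (2 * (1 - x * p x))) (Iio 1) := by
    have hp : ContinuousOn p (Iio 1) := fun x hx => (h.continuousAt hx).continuousWithinAt
    refine hp.div (by fun_prop) fun x hx => ?_
    have := hpos x hx
    positivity
  have hH : ∀ x < 1, HasDerivAt (fun x => ∫ t in (0 : ℝ)..x, p t / (2 * (1 - t * p t)))
      (p x / (2 * (1 - x * p x))) x := by
    intro x hx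
    refine intervalIntegral.integral_hasDerivAt_right ?_
      (hc.stronglyMeasurableAtFilter isOpen_Iio x hx) (hc.continuousAt (Iio_mem_nhds hx))
    refine (hc.mono fun t ht => ?_).intervalIntegrable
    exact ht.2.trans_lt (max_lt one_pos hx)
  refine ⟨_, intervalIntegral.integral_same, hH, ?_⟩
  set H : ℝ → ℝ := fun x => ∫ t in (0 : ℝ)..x, p t / (2 * (1 - t * p t)) with hHdef
  -- This comparison function is the same integral with p replaced by 1; since p ≥ 1, `H` grows at
  -- least as fast.
  have hlog : Tendsto (fun x : ℝ => -(Real.log (1 - x)) / 2) (𝓝[<] 1) atTop := by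
    have h1 : Tendsto (fun x : ℝ => 1 - x) (𝓝[<] 1) (𝓝[>] 0) := by
      rw [tendsto_nhdsWithin_iff]
      constructor
      · have : Tendsto (fun x : ℝ => 1 - x) (𝓝 1) (𝓝 (1 - 1)) :=
          (continuous_const.sub continuous_id).tendsto 1
        rw [sub_self] at this
        exact this.mono_left nhdsWithin_le_nhds
      · filter_upwards [self_mem_nhdsWithin] with x hx
        exact sub_pos.2 (mem_Iio.1 hx)
    exact (tendsto_neg_atBot_atTop.comp (Real.tendsto_log_nhdsGT_zero.comp h1)).atTop_div_const
      two_pos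
  refine tendsto_atTop_mono' _ ?_ hlog
  have hG : ∀ x < 1, HasDerivAt (fun x => H x + Real.log (1 - x) / 2)
      (p x / (2 * (1 - x * p x)) + -1 / (1 - x) / 2) x := fun x hx =>
    (hH x hx).add ((((hasDerivAt_id x).const_sub 1).log (sub_pos.2 hx).ne').div_const 2)
  have hmono : MonotoneOn (fun x => H x + Real.log (1 - x) / 2) (Ico 0 1) := by
    apply monotoneOn_of_hasDerivWithinAt_nonneg (convex_Ico 0 1)
      (fun x hx => (hG x hx.2).continuousAt.continuousWithinAt)
      (fun x hx => (hG x (interior_subset hx).2).hasDerivWithinAt)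
    intro x hx
    have hx' := (interior_subset hx).2
    have h1 := hpos x hx'
    have h2 : 0 < 1 - x := sub_pos.2 hx'
    have h3 := h.one_le ha hb hx'
    have : p x / (2 * (1 - x * p x)) + -1 / (1 - x) / 2 =
        (p x - 1) / (2 * (1 - x * p x) * (1 - x)) := by
      clear h3
      generalize p x = P at h1 ⊢
      have h1' := h1.ne'
      have h2' := h2.ne'
      rw [div_div, div_add_div _ _ (by positivity) (by positivity),
        div_eq_div_iff (by positivity) (by positivity)]
      ring
    rw [this]
    have h4 : 0 ≤ p x - 1 := by linarith
    positivity
  filter_upwards [Ioo_mem_nhdsLT (show (0 : ℝ) < 1 by norm_num)] with x hx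
  have := hmono (left_mem_Ico.2 one_pos) (Ioo_subset_Ico_self hx) hx.1.le
  simp only [hHdef, intervalIntegral.integral_same, sub_zero, Real.log_one, zero_div,
    add_zero] at this
  linarith

end IsPhaseProfile

/-! ### Profiles in the variable ξ -/

/-- The even self-similar profiles: the system for `(U, S)` obtained by eliminating `Θ`. -/
lemma exists_strain_stress_profile {a b S₀ : ℝ} (ha : 0 < a) (hb : 0 < b) (hS₀ : 0 < S₀) :
    ∃ U S : ℝ → ℝ, (∀ ξ, 0 < U ξ) ∧ (∀ ξ, 0 < S ξ) ∧ (∀ ξ, U (-ξ) = U ξ) ∧ (∀ ξ, S (-ξ) = S ξ) ∧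
      S 0 = S₀ ∧ S 0 * U 0 = (a + 1 + b) / a ∧ (∀ ξ, HasDerivAt S (ξ * U ξ) ξ) ∧
      (∀ ξ, HasDerivAt U
        (U ξ * (a * (S ξ * U ξ - (a + 1 + b) / a) + b * (ξ ^ 2 * U ξ / S ξ)) / ξ) ξ) ∧
      Tendsto (fun ξ => (a * (S ξ * U ξ - (a + 1 + b) / a) + b * (ξ ^ 2 * U ξ / S ξ)) / ξ)
        (𝓝 0) (𝓝 0) ∧
      Tendsto (fun ξ => S ξ * U ξ) atTop (𝓝 1) ∧ Tendsto (fun ξ => ξ / S ξ) atTop (𝓝 1) := by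
  obtain ⟨p, hp⟩ := exists_isPhaseProfile ha hb
  obtain ⟨H, hH0, hH, hHtop⟩ := hp.exists_logStress ha hb
  set c := (a + 1 + b) / a with hc
  have hac : a + 1 + b = a * c := by rw [hc]; field_simp
  -- `E` is the stress as a function of m = ξ/S, so that ξ = m E(m).
  let E : ℝ → ℝ := fun m => S₀ * Real.exp (H (m ^ 2))
  have hEpos : ∀ m, 0 < E m := fun m => by positivity
  have hsq : ∀ {m : ℝ}, m ∈ Ioo (-1 : ℝ) 1 → m ^ 2 < 1 := fun hm =>
    (sq_lt_one_iff_abs_lt_one _).2 (abs_lt.2 hm)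
  have hq : ∀ {m : ℝ}, m ∈ Ioo (-1 : ℝ) 1 → 0 < 1 - m ^ 2 * p (m ^ 2) := fun hm =>
    sub_pos.2 (hp.mul_lt_one ha hb (hsq hm))
  have hE : ∀ m ∈ Ioo (-1 : ℝ) 1,
      HasDerivAt E (E m * (m * p (m ^ 2) / (1 - m ^ 2 * p (m ^ 2)))) m := by
    intro m hm
    have h1 := (((hH _ (hsq hm)).comp (h := fun m => m ^ 2) m (hasDerivAt_pow 2 m)).exp).const_mul S₀
    refine h1.congr_deriv ?_
    have := hq hm
    simp only [E, Function.comp]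
    field_simp
    norm_num
    ring
  have hX : ∀ m ∈ Ioo (-1 : ℝ) 1,
      HasDerivAt (fun m => m * E m) (E m / (1 - m ^ 2 * p (m ^ 2))) m := by
    intro m hm
    refine ((hasDerivAt_id m).mul (hE m hm)).congr_deriv ?_
    have := hq hm
    simp only [id]
    field_simp
    ring
  have htop : Tendsto (fun m => m * E m) (𝓝[<] 1) atTop := by
    have h1 : Tendsto (fun m : ℝ => m ^ 2) (𝓝[<] 1) (𝓝[<] 1) := by
      rw [tendsto_nhdsWithin_iff]
      constructor
      · have : Tendsto (fun m : ℝ => m ^ 2) (𝓝 1) (𝓝 (1 ^ 2)) := (continuous_pow 2).tendsto 1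
        rw [one_pow] at this
        exact this.mono_left nhdsWithin_le_nhds
      · filter_upwards [Ioo_mem_nhdsLT (show (-1 : ℝ) < 1 by norm_num)] with m hm using hsq hm
    have h2 : Tendsto E (𝓝[<] 1) atTop :=
      (Real.tendsto_exp_atTop.comp (hHtop.comp h1)).const_mul_atTop hS₀
    exact (tendsto_id.mono_left nhdsWithin_le_nhds).pos_mul_atTop one_pos h2
  obtain ⟨M, hM, hXM, hodd, hMd, hM1⟩ := exists_odd_inverse hX
    (fun m hm => div_pos (hEpos m) (hq hm)) (fun m => by simp [E]) (fun B => by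
      obtain ⟨m, h1, h2⟩ := ((htop.eventually_ge_atTop B).and
        (Ioo_mem_nhdsLT (show (0 : ℝ) < 1 by norm_num))).exists
      exact ⟨m, h2, h1⟩)
  have hM0 : M 0 = 0 := by
    have := hodd 0
    rw [neg_zero] at this
    linarith
  have hpM : ∀ ξ, 0 < p (M ξ ^ 2) := fun ξ => one_pos.trans_le (hp.one_le ha hb (hsq (hM ξ)))
  have hMS : ∀ ξ, M ξ * E (M ξ) = ξ := hXM
  have hSd : ∀ ξ, HasDerivAt (fun ξ => E (M ξ)) (ξ * (p (M ξ ^ 2) / E (M ξ))) ξ := by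
    intro ξ
    refine ((hE _ (hM ξ)).comp ξ (hMd ξ)).congr_deriv ?_
    have h1 := hq (hM ξ)
    have h2 := hEpos (M ξ)
    have hS := hMS ξ
    generalize E (M ξ) = e at h2 hS ⊢
    generalize M ξ = m at h1 hS ⊢
    subst hS
    field_simp
  have hSU : ∀ ξ, E (M ξ) * (p (M ξ ^ 2) / E (M ξ)) = p (M ξ ^ 2) := fun ξ =>
    mul_div_cancel₀ _ (hEpos _).ne'
  have hrate : Tendsto (fun ξ => (a * (p (M ξ ^ 2) - c) +
      b * (ξ ^ 2 * (p (M ξ ^ 2) / E (M ξ)) / E (M ξ))) / ξ) (𝓝 0) (𝓝 0) := by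
    have hMt : Tendsto M (𝓝 0) (𝓝 0) := by
      have := (hMd 0).continuousAt.tendsto
      rwa [hM0] at this
    have hM2 : Tendsto (fun ξ => M ξ ^ 2) (𝓝 0) (𝓝 0) := by simpa using hMt.pow 2
    have h1 := hp.rate.comp hMt
    have h2 : Tendsto (fun ξ => p (M ξ ^ 2)) (𝓝 0) (𝓝 c) := by
      have := hp.continuousAt_zero.tendsto
      rw [hp.of_nonpos 0 le_rfl] at this
      exact this.comp hM2
    have h3 : Tendsto (fun ξ => (E (M ξ))⁻¹) (𝓝 0) (𝓝 (E (M 0))⁻¹) :=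
      ((hSd 0).continuousAt.inv₀ (hEpos _).ne').tendsto
    -- Substituting ξ = m E(m), the quotient equals (a(p(m²) - c)/m + b m p(m²))/E(m); the node rate
    -- handles the first term.
    have h4 := ((h1.const_mul a).add ((hMt.mul h2).const_mul b)).mul h3
    simp only [mul_zero, zero_mul, add_zero] at h4
    refine h4.congr fun ξ => ?_
    have h5 := hEpos (M ξ)
    rcases eq_or_ne (M ξ) 0 with h0 | h0
    · have : ξ = 0 := by rw [← hMS ξ, h0, zero_mul]
      simp [this, hM0]
    · have hS := hMS ξ
      simp only [Function.comp, ← hc]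
      generalize E (M ξ) = e at h5 hS ⊢
      generalize M ξ = m at h0 hS ⊢
      subst hS
      field_simp
  refine ⟨fun ξ => p (M ξ ^ 2) / E (M ξ), fun ξ => E (M ξ), fun ξ => div_pos (hpM ξ) (hEpos _),
    fun ξ => hEpos _, fun ξ => by simp [hodd, E], fun ξ => by simp [hodd, E],
    by simp [hM0, E, hH0], ?_, hSd, ?_, ?_, ?_, ?_⟩
  · rw [hSU, hM0, zero_pow two_ne_zero, hp.of_nonpos 0 le_rfl]
  · simp only [hSU]
    have hcont : ∀ ξ, ContinuousAt (fun ξ => p (M ξ ^ 2) / E (M ξ)) ξ := fun ξ =>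
      (ContinuousAt.comp (f := fun ξ => M ξ ^ 2) (hp.continuousAt (hsq (hM ξ)))
        ((hMd ξ).continuousAt.pow 2)).div (hSd ξ).continuousAt (hEpos _).ne'
    intro ξ
    -- The chain rule through p works only for ξ ≠ 0. At the origin the derivative is the limit of
    -- the nearby ones, which is 0 and agrees with the formula's value under division by zero.
    refine hasDerivAt_of_hasDerivAt_of_ne' (x := 0) (g := fun ξ => p (M ξ ^ 2) / E (M ξ) *
      (a * (p (M ξ ^ 2) - c) + b * (ξ ^ 2 * (p (M ξ ^ 2) / E (M ξ)) / E (M ξ))) / ξ)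
      (fun ξ hξ => ?_) (hcont 0) ?_ ξ
    · have hm0 : M ξ ≠ 0 := fun h => hξ (by rw [← hMS ξ, h, zero_mul])
      have h1 : M ξ ^ 2 ∈ Ioo (0 : ℝ) 1 := ⟨by positivity, hsq (hM ξ)⟩
      have h2 := (hp.hasDerivAt _ h1).comp ξ ((hMd ξ).pow 2)
      refine (h2.div (hSd ξ) (hEpos _).ne').congr_deriv ?_
      have h3 := hq (hM ξ)
      have h4 := hEpos (M ξ)
      have hS := hMS ξ
      simp only [Function.comp, phaseSlope, hac, Pi.pow_apply]
      clear h1 h2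
      generalize E (M ξ) = e at h4 hS ⊢
      generalize M ξ = m at h3 hS hm0 ⊢
      generalize p (m ^ 2) = P at h3 ⊢
      subst hS
      simp only [Nat.cast_ofNat, Nat.add_one_sub_one, pow_one]
      generalize 1 - m ^ 2 * P = Q at h3 ⊢
      field_simp
      ring
    · have h1 := (hcont 0).tendsto.mul hrate
      rw [mul_zero] at h1
      simp only [ContinuousAt, div_zero]
      refine h1.congr fun ξ => ?_
      ring
  · simpa only [hSU] using hrate
  · simp only [hSU]
    have h1 : Tendsto (fun ξ => M ξ ^ 2) atTop (𝓝[<] 1) := by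
      rw [tendsto_nhdsWithin_iff]
      exact ⟨by simpa using hM1.pow 2, .of_forall fun ξ => hsq (hM ξ)⟩
    exact (hp.tendsto_one ha hb).comp h1
  · refine hM1.congr fun ξ => ?_
    rw [eq_div_iff (hEpos _).ne', hMS]

/-- Second order Taylor expansion at the origin of an antiderivative of `ξ U`. -/
lemma isLittleO_sub_taylor_of_hasDerivAt_mul {S U : ℝ → ℝ} (hU : ContinuousAt U 0)
    (hS : ∀ ξ, HasDerivAt S (ξ * U ξ) ξ) :
    (fun ξ => S ξ - (S 0 + 1 / 2 * U 0 * ξ ^ 2)) =o[𝓝[>] 0] (fun ξ => ξ ^ 2) := by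
  rw [isLittleO_iff]
  intro ε hε
  obtain ⟨δ, hδ, hδU⟩ := Metric.continuousAt_iff.1 hU ε hε
  filter_upwards [Ioo_mem_nhdsGT hδ] with ξ hξ
  have hg : ∀ t, HasDerivAt (fun t => S t - (S 0 + 1 / 2 * U 0 * t ^ 2)) (t * (U t - U 0)) t := by
    intro t
    refine ((hS t).sub (((hasDerivAt_pow 2 t).const_mul (1 / 2 * U 0)).const_add (S 0))).congr_deriv
      ?_
    norm_num
    ring
  -- The remainder has derivative t(U(t) - U(0)), at most ξε on `[0, ξ)`, so the mean value
  -- inequality yields ε ξ².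
  have h := norm_image_sub_le_of_norm_deriv_le_segment' (a := 0) (b := ξ) (C := ξ * ε)
    (fun t _ => (hg t).hasDerivWithinAt) (fun t ht => by
      rw [norm_mul, Real.norm_eq_abs, abs_of_nonneg ht.1]
      have h1 : ‖U t - U 0‖ ≤ ε := by
        refine (hδU ?_).le
        rw [Real.dist_eq, sub_zero, abs_of_nonneg ht.1]
        exact ht.2.trans hξ.2
      exact mul_le_mul ht.2.le h1 (norm_nonneg _) hξ.1.le) ξ (right_mem_Icc.2 hξ.1.le)
  simp only [ne_eq, OfNat.ofNat_ne_zero, not_false_eq_true, zero_pow, mul_zero, add_zero, sub_self,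
    sub_zero] at h
  rw [norm_pow, Real.norm_eq_abs ξ, abs_of_pos hξ.1]
  linarith

/-- The even shear band profiles, regular on the whole line. -/
lemma exists_shear_profile {α n ν S₀ : ℝ} (hα : 0 < α) (hn : 0 < n) (hν : 0 < ν) (hS₀ : 0 < S₀) :
    ∃ U S Θ : ℝ → ℝ, IsShearProfile α n ν S₀ U S Θ ∧
      (∀ ξ, U (-ξ) = U ξ) ∧ (∀ ξ, S (-ξ) = S ξ) ∧ (∀ ξ, Θ (-ξ) = Θ ξ) ∧
      (∀ ξ, 0 < U ξ) ∧ ContDiff ℝ 1 U ∧ ContDiff ℝ 2 S ∧ ContDiff ℝ 1 Θ ∧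
      (∀ ξ, HasDerivAt S (ξ * U ξ) ξ) ∧
      (∀ ξ, ν * ((n + 1) / α + ξ * deriv Θ ξ) = S ξ * U ξ - 1) ∧
      (∀ ξ, S ξ = Real.exp (-α * Θ ξ) * U ξ ^ n) := by
  obtain ⟨U, S, hU, hS, hUe, hSe, hS0, hSU0, hSd, hUd, hrate, hSU, hξS⟩ :=
    exists_strain_stress_profile (a := α / (ν * n)) (b := 1 / n) (S₀ := S₀) (by positivity)
      (by positivity) hS₀
  have hc : (α / (ν * n) + 1 + 1 / n) / (α / (ν * n)) = profileConst α n ν := by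
    rw [profileConst]
    field_simp
    ring
  rw [hc] at hSU0 hrate
  simp only [hc] at hUd
  set c := profileConst α n ν with hcdef
  have hcpos : 0 < c := by rw [← hSU0]; exact mul_pos (hS 0) (hU 0)
  have hUc : Continuous U := continuous_iff_continuousAt.2 fun ξ => (hUd ξ).continuousAt
  have hSc : Continuous S := continuous_iff_continuousAt.2 fun ξ => (hSd ξ).continuousAt
  have hU1 : ContDiff ℝ 1 U := by
    rw [contDiff_one_iff_deriv]
    refine ⟨fun ξ => (hUd ξ).differentiableAt, ?_⟩
    rw [show deriv U = _ from funext fun ξ => (hUd ξ).deriv, continuous_iff_continuousAt]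
    intro ξ
    rcases eq_or_ne ξ 0 with rfl | h0
    · have h1 := (hUc.tendsto 0).mul hrate
      rw [mul_zero] at h1
      simp only [ContinuousAt, div_zero]
      exact h1.congr fun ξ => by ring
    · have h1 := (hS ξ).ne'
      have h2 := hUc.continuousAt (x := ξ)
      have h3 := hSc.continuousAt (x := ξ)
      exact (h2.mul ((continuousAt_const.mul ((h3.mul h2).sub continuousAt_const)).add
        (continuousAt_const.mul (((continuousAt_id.pow 2).mul h2).div h3 h1)))).div
          continuousAt_id h0
  have hS2 : ContDiff ℝ 2 S := by
    rw [show (2 : WithTop ℕ∞) = 1 + 1 from one_add_one_eq_two.symm, contDiff_succ_iff_deriv]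
    refine ⟨fun ξ => (hSd ξ).differentiableAt, by simp, ?_⟩
    rw [show deriv S = _ from funext fun ξ => (hSd ξ).deriv]
    exact contDiff_id.mul hU1
  -- The constitutive law solved for the temperature; the energy equation then reproduces the
  -- equation for U'.
  let Θ : ℝ → ℝ := fun ξ => (n * Real.log (U ξ) - Real.log (S ξ)) / α
  have hΘ1 : ContDiff ℝ 1 Θ :=
    ((contDiff_const.mul (hU1.log fun ξ => (hU ξ).ne')).sub
      ((hS2.of_le (by norm_num)).log fun ξ => (hS ξ).ne')).div_const α
  have hΘd : ∀ ξ, HasDerivAt Θ ((S ξ * U ξ - c) / (ν * ξ)) ξ := by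
    intro ξ
    refine (((((hUd ξ).log (hU ξ).ne').const_mul n).sub
      ((hSd ξ).log (hS ξ).ne')).div_const α).congr_deriv ?_
    have h1 := hU ξ
    have h2 := hS ξ
    rcases eq_or_ne ξ 0 with rfl | h0
    · simp
    · field_simp
      ring
  have henergy : ∀ ξ, ν * ((n + 1) / α + ξ * deriv Θ ξ) = S ξ * U ξ - 1 := by
    intro ξ
    rw [(hΘd ξ).deriv]
    rcases eq_or_ne ξ 0 with rfl | h0
    · rw [hSU0, hcdef, profileConst]
      ring
    · have : ξ * ((S ξ * U ξ - c) / (ν * ξ)) = (S ξ * U ξ - c) / ν := by field_simp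
      rw [this, mul_add, mul_div_cancel₀ _ hν.ne', hcdef, profileConst]
      ring
  have hconst : ∀ ξ, S ξ = Real.exp (-α * Θ ξ) * U ξ ^ n := by
    intro ξ
    have : -α * Θ ξ = Real.log (S ξ) - Real.log (U ξ) * n := by
      simp only [Θ]
      field_simp
      ring
    rw [this, Real.rpow_def_of_pos (hU ξ), ← Real.exp_add, sub_add_cancel, Real.exp_log (hS ξ)]
  have hΘe : ∀ ξ, Θ (-ξ) = Θ ξ := fun ξ => by simp only [Θ, hUe, hSe]
  have hξU : Tendsto (fun ξ => ξ * U ξ) atTop (𝓝 1) := by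
    have h1 := hξS.mul hSU
    rw [one_mul] at h1
    refine h1.congr fun ξ => ?_
    have := (hS ξ).ne'
    field_simp
  have hU0 : HasDerivAt U 0 0 := by simpa using hUd 0
  have hΘ0 : HasDerivAt Θ 0 0 := by simpa using hΘd 0
  have htaylor : ∀ {f : ℝ → ℝ}, HasDerivAt f 0 0 →
      (fun ξ => f ξ - f 0) =o[𝓝[>] 0] (fun ξ => ξ) := by
    intro f hf
    have h1 := hasDerivAt_iff_isLittleO.1 hf
    simp only [sub_zero, smul_zero] at h1
    exact h1.mono nhdsWithin_le_nhds
  refine ⟨U, S, Θ, ?_, hUe, hSe, hΘe, hU, hU1, hS2, hΘ1, hSd, henergy, hconst⟩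
  refine
    { U_pos := fun ξ _ => hU ξ
      stress_deriv := fun ξ _ => (hSd ξ).hasDerivWithinAt
      energy := fun ξ hξ => ?_
      constitutive := fun ξ _ => hconst ξ
      S_zero := hS0
      U_zero := by rw [← hS0, mul_comm, hSU0]
      Θ_zero := ?_
      U_contDiff := hU1.contDiffOn
      Θ_contDiff := hΘ1.contDiffOn
      S_contDiff := hS2.contDiffOn
      U_deriv_zero := hU0.hasDerivWithinAt
      S_deriv_zero := by simpa using (hSd 0).hasDerivWithinAt (s := Ici 0)
      Θ_deriv_zero := hΘ0.hasDerivWithinAt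
      U_taylor := htaylor hU0
      S_taylor := by
        rw [← hS0]
        exact isLittleO_sub_taylor_of_hasDerivAt_mul hUc.continuousAt hSd
      Θ_taylor := htaylor hΘ0
      U_atTop := ?_
      S_atTop := ?_
      Θ_atTop := ?_ }
  · rw [(hΘd ξ).hasDerivWithinAt.derivWithin (uniqueDiffOn_Ici 0 ξ hξ), ← (hΘd ξ).deriv]
    exact henergy ξ
  · rw [← hcdef, ← hSU0, Real.log_mul (hS 0).ne' (hU 0).ne']
    simp only [Θ]
    ring
  · rw [isLittleO_iff_tendsto' (by
      filter_upwards [eventually_gt_atTop 0] with ξ hξ h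
      exact absurd h (by positivity))]
    have h1 := hξU.sub_const 1
    rw [sub_self] at h1
    refine h1.congr' ?_
    filter_upwards [eventually_gt_atTop 0] with ξ hξ
    field_simp
  · rw [isLittleO_iff_tendsto' (by
      filter_upwards [eventually_gt_atTop 0] with ξ hξ h
      exact absurd h hξ.ne')]
    have h1 := (hξS.inv₀ one_ne_zero).sub_const 1
    rw [inv_one, sub_self] at h1
    refine h1.congr' ?_
    filter_upwards [eventually_gt_atTop 0] with ξ hξ
    rw [inv_div, sub_div, div_self hξ.ne']
  · have h1 := ((((Real.continuousAt_log one_ne_zero).tendsto.comp hξU).const_mul n).add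
      ((Real.continuousAt_log one_ne_zero).tendsto.comp hξS)).div_const α
    rw [Real.log_one, mul_zero, add_zero, zero_div] at h1
    refine h1.congr' ?_
    filter_upwards [eventually_gt_atTop 0] with ξ hξ
    simp only [Function.comp, Θ]
    rw [Real.log_mul hξ.ne' (hU ξ).ne', Real.log_div hξ.ne' (hS ξ).ne']
    ring

/-! ### Time-dependent scaling and the self-similar solution -/

section Band

variable {α θ₀ lam t : ℝ}

lemma bandScale_base_pos (hα : 0 < α) (ht : 0 ≤ t) : 0 < α / Real.exp (α * θ₀) * t + 1 := by
  positivity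

lemma bandScale_pos (hα : 0 < α) (ht : 0 ≤ t) : 0 < bandScale α θ₀ lam t :=
  Real.rpow_pos_of_pos (bandScale_base_pos hα ht) _

lemma hasDerivAt_uniformTemp (hα : 0 < α) (ht : 0 ≤ t) :
    HasDerivAt (uniformTemp α θ₀) (uniformStress α θ₀ t) t := by
  have h : 0 < α * t + Real.exp (α * θ₀) := by positivity
  refine (((((hasDerivAt_id t).const_mul α).add_const _).log h.ne').const_mul (1 / α)).congr_deriv ?_
  simp only [uniformStress, id]
  field_simp

lemma hasDerivAt_bandScale (hα : 0 < α) (ht : 0 ≤ t) :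
    HasDerivAt (bandScale α θ₀ lam) (lam * uniformStress α θ₀ t * bandScale α θ₀ lam t) t := by
  have h := bandScale_base_pos (θ₀ := θ₀) hα ht
  have h1 : 0 < α * t + Real.exp (α * θ₀) := by positivity
  refine ((((hasDerivAt_id t).const_mul (α / Real.exp (α * θ₀))).add_const 1).rpow_const
    (p := lam / α) (Or.inl h.ne')).congr_deriv ?_
  simp only [id]
  rw [Real.rpow_sub_one h.ne', bandScale, uniformStress]
  have h2 : α / Real.exp (α * θ₀) * t + 1 = (α * t + Real.exp (α * θ₀)) / Real.exp (α * θ₀) := by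
    field_simp
  generalize (α / Real.exp (α * θ₀) * t + 1) ^ (lam / α) = w
  rw [h2]
  have h3 := Real.exp_pos (α * θ₀)
  generalize Real.exp (α * θ₀) = z at h1 h3 ⊢
  field_simp

lemma contDiffOn_bandScale (hα : 0 < α) {k : WithTop ℕ∞} :
    ContDiffOn ℝ k (bandScale α θ₀ lam) (Ici 0) := by
  unfold bandScale
  exact ContDiffOn.rpow_const_of_ne (by fun_prop) fun t ht => (bandScale_base_pos hα ht).ne'

lemma contDiffOn_uniformTemp (hα : 0 < α) {k : WithTop ℕ∞} :
    ContDiffOn ℝ k (uniformTemp α θ₀) (Ici 0) := by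
  unfold uniformTemp
  refine contDiffOn_const.mul (ContDiffOn.log (by fun_prop) fun t ht => ?_)
  have ht' : 0 ≤ t := ht
  positivity

lemma contDiffOn_uniformStress (hα : 0 < α) {k : WithTop ℕ∞} :
    ContDiffOn ℝ k (uniformStress α θ₀) (Ici 0) := by
  unfold uniformStress
  refine contDiffOn_const.div (by fun_prop) fun t ht => ?_
  have ht' : 0 ≤ t := ht
  positivity

lemma tendsto_bandScale_atTop (hα : 0 < α) (hlam : 0 < lam) :
    Tendsto (bandScale α θ₀ lam) atTop atTop := by
  refine (tendsto_rpow_atTop (div_pos hlam hα)).comp ?_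
  exact tendsto_atTop_add_const_right _ _ (tendsto_id.const_mul_atTop (by positivity))

/-- Here σ_s = exp(-α θ_s) and φ = exp(λ(θ_s - θ₀)), so the exponential equals σ_s φ^{-(n+1)}. This
is the constitutive law for the prefactors. -/
lemma uniformStress_mul_inv_bandScale (n : ℝ) (hα : 0 < α) (ht : 0 ≤ t) :
    uniformStress α θ₀ t * (bandScale α θ₀ lam t)⁻¹ =
      Real.exp (-α * ((1 + lam * ((n + 1) / α)) * uniformTemp α θ₀ t
        - lam * ((n + 1) / α) * θ₀)) * bandScale α θ₀ lam t ^ n := by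
  have h1 : 0 < α * t + Real.exp (α * θ₀) := by positivity
  have h2 : α / Real.exp (α * θ₀) * t + 1 = (α * t + Real.exp (α * θ₀)) / Real.exp (α * θ₀) := by
    field_simp
  have h3 : bandScale α θ₀ lam t =
      Real.exp ((Real.log (α * t + Real.exp (α * θ₀)) - α * θ₀) * (lam / α)) := by
    rw [bandScale, Real.rpow_def_of_pos (bandScale_base_pos hα ht), h2,
      Real.log_div h1.ne' (Real.exp_pos _).ne', Real.log_exp]
  have h4 : uniformStress α θ₀ t = Real.exp (-Real.log (α * t + Real.exp (α * θ₀))) := by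
    rw [uniformStress, Real.exp_neg, Real.exp_log h1, one_div]
  rw [h3, h4, ← Real.exp_neg, ← Real.exp_add, ← Real.exp_mul, ← Real.exp_add, uniformTemp]
  congr 1
  field_simp
  ring

end Band

/-- Regular profiles on the line generate self-similar solutions of the shear system. -/
lemma isAdiabaticShearSolution_of_profile {α n lam θ₀ : ℝ} {U S Θ : ℝ → ℝ} (hα : 0 < α)
    (hlam : 0 < lam) (hU : ∀ ξ, 0 < U ξ) (hU1 : ContDiff ℝ 1 U) (hS2 : ContDiff ℝ 2 S)
    (hΘ1 : ContDiff ℝ 1 Θ) (hSd : ∀ ξ, HasDerivAt S (ξ * U ξ) ξ)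
    (henergy : ∀ ξ, lam * ((n + 1) / α + ξ * deriv Θ ξ) = S ξ * U ξ - 1)
    (hconst : ∀ ξ, S ξ = Real.exp (-α * Θ ξ) * U ξ ^ n) :
    IsAdiabaticShearSolution α n
      (fun x t => bandScale α θ₀ lam t * U (√lam * x * bandScale α θ₀ lam t))
      (fun x t => uniformStress α θ₀ t * (bandScale α θ₀ lam t)⁻¹ *
        S (√lam * x * bandScale α θ₀ lam t))
      (fun x t => (1 + lam * ((n + 1) / α)) * uniformTemp α θ₀ t - lam * ((n + 1) / α) * θ₀ +
        Θ (√lam * x * bandScale α θ₀ lam t)) := by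
  have hsnd : MapsTo (Prod.snd : ℝ × ℝ → ℝ) (univ ×ˢ Ici 0) (Ici 0) := fun z hz => hz.2
  have hφ : ∀ {k : WithTop ℕ∞}, ContDiffOn ℝ k (fun z : ℝ × ℝ => bandScale α θ₀ lam z.2)
      (univ ×ˢ Ici 0) := (contDiffOn_bandScale hα).comp contDiffOn_snd hsnd
  have hξ : ∀ {k : WithTop ℕ∞}, ContDiffOn ℝ k
      (fun z : ℝ × ℝ => √lam * z.1 * bandScale α θ₀ lam z.2) (univ ×ˢ Ici 0) :=
    (contDiffOn_const.mul contDiffOn_fst).mul hφ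
  have hlam2 : √lam * √lam = lam := Real.mul_self_sqrt hlam.le
  have hξt : ∀ x t, 0 ≤ t → HasDerivAt (fun s => √lam * x * bandScale α θ₀ lam s)
      (√lam * x * (lam * uniformStress α θ₀ t * bandScale α θ₀ lam t)) t := fun x t ht =>
    (hasDerivAt_bandScale hα ht).const_mul _
  refine
    { u_pos := fun x t ht => mul_pos (bandScale_pos hα ht) (hU _)
      u_contDiff := hφ.mul (hU1.comp_contDiffOn hξ)
      θ_contDiff := ?_
      σ_contDiff := ?_
      momentum := fun x t ht => ?_
      energy := fun x t ht => ?_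
      constitutive := fun x t ht => ?_ }
  · exact ((contDiffOn_const.mul ((contDiffOn_uniformTemp hα).comp contDiffOn_snd hsnd)).sub
      contDiffOn_const).add (hΘ1.comp_contDiffOn hξ)
  · exact (((contDiffOn_uniformStress hα).comp contDiffOn_snd hsnd).mul
      (hφ.inv fun z hz => (bandScale_pos hα hz.2).ne')).mul (hS2.comp_contDiffOn hξ)
  · have hUd : ∀ ξ, HasDerivAt U (deriv U ξ) ξ := fun ξ =>
      ((hU1.differentiable one_ne_zero) ξ).hasDerivAt
    have hut := (hasDerivAt_bandScale (θ₀ := θ₀) (lam := lam) hα ht).mul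
      ((hUd _).comp t (hξt x t ht))
    refine HasDerivAt.hasDerivWithinAt (hut.congr_deriv ?_)
    have hφ0 := inv_mul_cancel₀ (bandScale_pos (θ₀ := θ₀) (lam := lam) hα ht).ne'
    simp only [Function.comp]
    generalize bandScale α θ₀ lam t = φ at hφ0 ⊢
    generalize uniformStress α θ₀ t = s
    have hξx : ∀ y, HasDerivAt (fun y => √lam * y * φ) (√lam * φ) y := fun y => by
      simpa using ((hasDerivAt_id y).const_mul (√lam)).mul_const φ
    have hd1 : deriv (fun y => s * φ⁻¹ * S (√lam * y * φ)) = fun y => s * φ⁻¹ *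
        (√lam * y * φ * U (√lam * y * φ) * (√lam * φ)) := funext fun y =>
      (((hSd _).comp y (hξx y)).const_mul (s * φ⁻¹)).deriv
    have hd2 := ((((hξx x).mul ((hUd _).comp x (hξx x))).mul_const (√lam * φ)).const_mul
      (s * φ⁻¹)).deriv
    rw [iteratedDeriv_succ, iteratedDeriv_one, hd1]
    refine Eq.trans ?_ hd2.symm
    simp only [Function.comp]
    generalize U (√lam * x * φ) = v
    generalize deriv U (√lam * x * φ) = w
    -- Both sides are λ σ_s φ (ξU)'; the two x-derivatives supply λ as `√lam * √lam`, and one factor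
    -- φ cancels the prefactor φ⁻¹.
    linear_combination (-s * (φ * v + √lam * x * φ ^ 2 * w)) * hlam2
      - s * (φ * v + √lam * x * φ ^ 2 * w) * √lam ^ 2 * hφ0
  · have hΘd : HasDerivAt Θ (deriv Θ (√lam * x * bandScale α θ₀ lam t))
        (√lam * x * bandScale α θ₀ lam t) := ((hΘ1.differentiable one_ne_zero) _).hasDerivAt
    have hθt := (((hasDerivAt_uniformTemp (θ₀ := θ₀) hα ht).const_mul
      (1 + lam * ((n + 1) / α))).sub_const (lam * ((n + 1) / α) * θ₀)).add
        (hΘd.comp t (hξt x t ht))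
    refine HasDerivAt.hasDerivWithinAt (hθt.congr_deriv ?_)
    have h1 := henergy (√lam * x * bandScale α θ₀ lam t)
    have hφ0 := (bandScale_pos (θ₀ := θ₀) (lam := lam) hα ht).ne'
    generalize bandScale α θ₀ lam t = φ at hφ0 h1 ⊢
    generalize uniformStress α θ₀ t = s
    have h2 : s * φ⁻¹ * S (√lam * x * φ) * (φ * U (√lam * x * φ)) =
        s * (S (√lam * x * φ) * U (√lam * x * φ)) := by field_simp
    rw [h2]
    linear_combination s * h1
  · rw [Real.mul_rpow (bandScale_pos hα ht).le (hU _).le, hconst, mul_add, Real.exp_add,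
      uniformStress_mul_inv_bandScale n hα ht]
    ring

theorem mainTheorem1 (α n lam S₀ : ℝ) (hα : 0 < α) (hn : 0 < n) (hlam : 0 < lam) (hS₀ : 0 < S₀) :
    ∃ U S Θ : ℝ → ℝ,
      IsShearProfile α n lam S₀ U S Θ ∧
      (∀ ξ, U (-ξ) = U ξ) ∧ (∀ ξ, S (-ξ) = S ξ) ∧ (∀ ξ, Θ (-ξ) = Θ ξ) ∧
      ∀ θ₀ : ℝ, 0 < θ₀ →
        IsAdiabaticShearSolution α n
          (fun x t => bandScale α θ₀ lam t * U (√lam * x * bandScale α θ₀ lam t))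
          (fun x t => uniformStress α θ₀ t * (bandScale α θ₀ lam t)⁻¹ *
            S (√lam * x * bandScale α θ₀ lam t))
          (fun x t => (1 + lam * ((n + 1) / α)) * uniformTemp α θ₀ t - lam * ((n + 1) / α) * θ₀ +
            Θ (√lam * x * bandScale α θ₀ lam t)) ∧
        -- localization: the level curves of the similarity variable accumulate along `x = 0`
        Tendsto (bandScale α θ₀ lam) atTop atTop ∧
        ∀ (ξ : ℝ) (X : ℝ → ℝ), (∀ t, 0 ≤ t → √lam * X t * bandScale α θ₀ lam t = ξ) →
          Tendsto X atTop (𝓝 0) := by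
  obtain ⟨U, S, Θ, hprof, hUe, hSe, hΘe, hU, hU1, hS2, hΘ1, hSd, henergy, hconst⟩ :=
    exists_shear_profile hα hn hlam hS₀
  refine ⟨U, S, Θ, hprof, hUe, hSe, hΘe, fun θ₀ _ => ⟨isAdiabaticShearSolution_of_profile hα hlam
    hU hU1 hS2 hΘ1 hSd henergy hconst, tendsto_bandScale_atTop hα hlam, fun ξ X hX => ?_⟩⟩
  have hs : 0 < √lam := Real.sqrt_pos.2 hlam
  have h1 : Tendsto (fun t => ξ / (√lam * bandScale α θ₀ lam t)) atTop (𝓝 0) :=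
    tendsto_const_nhds.div_atTop ((tendsto_bandScale_atTop hα hlam).const_mul_atTop hs)
  refine h1.congr' ?_
  filter_upwards [eventually_ge_atTop 0] with t ht
  have h2 := bandScale_pos (θ₀ := θ₀) (lam := lam) hα ht
  rw [← hX t ht]
  field_simp
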